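/- For $f\in L^1_{\rm loc}(\mathbb R)$ and $0<\beta<1$ let $$M_\beta f(x)=\sup_{r\ge 0}\frac{r^\beta}{|B(x,r)|}\int_{B(x,r)}|f(y)|\,dy\qquad(x\in\mathbb R),$$ where $B(x,r)=(x-r,x+r)$ (the term $r=0$ being read as $0$), be the centered fractional maximal function. Let $W^{1,1}(\mathbb R)$ be the Sobolev space of real-valued functions $f\in L^1(\mathbb R)$ whose weak derivative $f'$ lies in $L^1(\mathbb R)$, with norm $\|f\|_{L^1}+\|f'\|_{L^1}$. Let $0<\beta<1$ and $q=1/(1-\beta)$. If $f\in W^{1,1}(\mathbb R)$, then $M_\beta f$ is finite everywhere and differentiable almost everywhere, its derivative $(M_\beta f)'$ belongs to $L^q(\mathbb R)$, and $$\|(M_\beta f)'\|_{L^q(\mathbb R)}\le C\,\|f'\|_{L^1(\mathbb R)},\qquad C=2^{-3\beta-2+\frac4\beta}\,3^{\frac{2(1-\beta)^2}{\beta}}.$$ Moreover, the map $f\mapsto|(M_\beta f)'|$ is continuous from $W^{1,1}(\mathbb R)$ to $L^q(\mathbb R)$. -/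

import Mathlib

open MeasureTheory Set
open scoped ENNReal ContDiff

noncomputable section

/-- The locally integrable function `g` is a weak derivative of the locally integrable function `f`
on the real line: integration by parts against every smooth, compactly supported test function. -/
structure HasWeakDeriv (f g : ℝ → ℝ) : Prop where
  locallyIntegrable : LocallyIntegrable f volume
  locallyIntegrable_deriv : LocallyIntegrable g volume
  integral_mul_deriv : ∀ φ : ℝ → ℝ, ContDiff ℝ ∞ φ → HasCompactSupport φ →
    ∫ x, f x * deriv φ x = -∫ x, g x * φ x

/-- `f` belongs to the Sobolev space `W^{1,1}(ℝ)` and `f'` is (a representative of) its weak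
derivative. -/
structure IsW11 (f f' : ℝ → ℝ) : Prop where
  integrable : Integrable f volume
  integrable_deriv : Integrable f' volume
  hasWeakDeriv : HasWeakDeriv f f'

/-- The centered fractional maximal function
`M_β f (x) = sup_{r ≥ 0} r ^ β / |B(x, r)| * ∫_{B(x, r)} |f|`, with values in `[0, ∞]`.
The term `r = 0` is `0` when `β ≠ 0`. -/
def fracMaxENN (β : ℝ) (f : ℝ → ℝ) (x : ℝ) : ℝ≥0∞ :=
  ⨆ (r : ℝ) (_ : 0 ≤ r),
    ENNReal.ofReal (r ^ β) / volume (Metric.ball x r) * ∫⁻ y in Metric.ball x r, ‖f y‖ₑ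

/-- The centered fractional maximal function as a real-valued function
(the faithful value wherever `fracMaxENN` is finite). -/
def fracMax (β : ℝ) (f : ℝ → ℝ) (x : ℝ) : ℝ :=
  (fracMaxENN β f x).toReal

/-- The `W^{1,1}(ℝ)` norm `‖f‖₁ + ‖f'‖₁` of a function `f` with weak derivative `f'`. -/
def normW11 (f f' : ℝ → ℝ) : ℝ≥0∞ :=
  eLpNorm f 1 volume + eLpNorm f' 1 volume

end

/-! Only `u = |F|` matters, where `F` is the absolutely continuous representative of `f`; write `g =
f'`. If `f ≠ 0`, the averages `fracAvg β u x r` are small for small and for large `r`, so the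
supremum is attained at some `r > 0`. Let `a` be the mean of `u` over an optimal ball `B(x, r)`.
Stationarity in the radius gives `u (x + r) + u (x - r) = 2 (1 - β) a`; touching from below in the
centre gives `(M_β f)'(x) = r ^ (β - 1) / 2 * (u (x + r) - u (x - r))` (`IsOptRadius.deriv_eq`).
Hence `|(M_β f)'(x)| ≤ (1 - β) r ^ (β - 1) a`. One endpoint value is at most `(1 - β) a`, while `u`
reaches its mean `a` on the closed ball, so `F` varies by at least `β a / 2` while `|F|` stays in
the strip `[(1 - β / 2) a, a]` (`IsOptRadius.ballAvg_le_integral`).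

With `I(x)` the integral of `|g|` over that part of the ball, the power `q = 1 / (1 - β)` turns `r ^
(β - 1)` into `1 / r`, so `|(M_β f)'(x)| ^ q` is at most a constant times `‖g‖₁ ^ (q - 1) * I(x) /
r(x)`. After exchanging integrals, it remains to bound `∫ dx / r(x)` over the `x` whose strip set
contains a given `y`. These balls share `y` and their means agree up to a factor `2`, so maximality
makes their radii comparable (`IsOptRadius.le_radiusRatio_mul`) and the integral is bounded
independently of `y` (`lintegral_stripSet_le`).

For continuity at `f ≠ 0`, limits of optimal radii are optimal, so the derivative formula yields
almost everywhere convergence. Dominated convergence handles compact intervals. In the tails, large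
optimal radii give explicit decay, and small ones keep the ball far from the origin, where a
localized form of the bound applies (`lintegral_tail_le`). At `f = 0` continuity follows from the
bound itself. -/

open Filter Topology

/-! ### Absolutely continuous representatives of `W^{1,1}` functions. -/

/-- A smooth compactly supported function on the line with zero integral is the derivative of a
smooth compactly supported function. -/
theorem exists_hasCompactSupport_primitive {χ : ℝ → ℝ} (hχ : ContDiff ℝ ∞ χ)
    (hs : HasCompactSupport χ) (h0 : ∫ x, χ x = 0) :
    ∃ φ : ℝ → ℝ, ContDiff ℝ ∞ φ ∧ HasCompactSupport φ ∧ deriv φ = χ := by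
  obtain ⟨R, hR⟩ := hs.isCompact.isBounded.subset_closedBall (0 : ℝ)
  have hzero : ∀ x, R < |x| → χ x = 0 := by
    intro x hx
    by_contra h
    have := hR (subset_tsupport _ h)
    simp only [Metric.mem_closedBall, dist_zero_right, Real.norm_eq_abs] at this
    linarith
  have hcont := hχ.continuous
  have hint : Integrable χ := hcont.integrable_of_hasCompactSupport hs
  have hderiv : ∀ x, HasDerivAt (fun x => ∫ t in Iic x, χ t) (χ x) x := fun x => by
    have h1 : (fun x => ∫ t in Iic x, χ t) =
        fun x => (∫ t in Iic 0, χ t) + ∫ t in (0 : ℝ)..x, χ t := by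
      funext z
      rw [← intervalIntegral.integral_Iic_sub_Iic hint.integrableOn hint.integrableOn]
      ring
    rw [h1]
    exact (intervalIntegral.integral_hasDerivAt_right (hcont.intervalIntegrable _ _)
      (hcont.stronglyMeasurableAtFilter _ _) hcont.continuousAt).const_add _
  have hd : deriv (fun x => ∫ t in Iic x, χ t) = χ := funext fun x => (hderiv x).deriv
  refine ⟨fun x => ∫ t in Iic x, χ t, ?_, ?_, hd⟩
  · rw [contDiff_infty_iff_deriv, hd]
    exact ⟨fun x => (hderiv x).differentiableAt, hχ⟩
  · refine HasCompactSupport.intro (isCompact_closedBall (0 : ℝ) R) ?_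
    intro x hx
    simp only [Metric.mem_closedBall, dist_zero_right, Real.norm_eq_abs, not_le] at hx
    rcases lt_or_ge x 0 with hx0 | hx0
    · rw [abs_of_neg hx0] at hx
      refine setIntegral_eq_zero_of_forall_eq_zero fun t ht => hzero t ?_
      have : -t ≤ |t| := neg_le_abs t
      have : t ≤ x := ht
      linarith
    · rw [abs_of_nonneg hx0] at hx
      have h1 : ∫ t in Ioi x, χ t = 0 := by
        refine setIntegral_eq_zero_of_forall_eq_zero fun t ht => hzero t ?_
        have : t ≤ |t| := le_abs_self t
        have : x < t := ht
        linarith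
      have h2 := intervalIntegral.integral_Iic_add_Ioi (b := x) hint.integrableOn hint.integrableOn
      rw [h0, h1] at h2
      simpa using h2

/-- The du Bois-Reymond lemma: a locally integrable function with vanishing weak derivative is
almost everywhere constant. -/
theorem ae_eq_const_of_integral_mul_deriv_eq_zero {h : ℝ → ℝ} (hh : LocallyIntegrable h volume)
    (h0 : ∀ φ : ℝ → ℝ, ContDiff ℝ ∞ φ → HasCompactSupport φ → ∫ x, h x * deriv φ x = 0) :
    ∃ c : ℝ, ∀ᵐ x, h x = c := by
  let b : ContDiffBump (0 : ℝ) := ⟨1, 2, one_pos, one_lt_two⟩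
  set η : ℝ → ℝ := b.normed volume with hη
  have hηs : ContDiff ℝ ∞ η := b.contDiff_normed
  have hηc : HasCompactSupport η := b.hasCompactSupport_normed
  have hη1 : ∫ x, η x = 1 := b.integral_normed
  have key : ∀ ψ : ℝ → ℝ, Continuous ψ → HasCompactSupport ψ →
      Integrable (fun x => h x * ψ x) := by
    intro ψ hψ hψc
    have := hh.integrable_smul_right_of_hasCompactSupport hψ hψc
    simpa using this
  -- As `η` has unit mass, `ψ - (∫ ψ) η` has zero mean and is an admissible derivative for every
  -- test function `ψ`; testing `h` against it identifies the constant.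
  refine ⟨∫ x, h x * η x, ?_⟩
  refine ae_eq_of_integral_contDiff_smul_eq hh (locallyIntegrable_const _) fun ψ hψ hψc => ?_
  have hψi : Integrable ψ := hψ.continuous.integrable_of_hasCompactSupport hψc
  have hηi : Integrable η := hηs.continuous.integrable_of_hasCompactSupport hηc
  obtain ⟨φ, hφ, hφc, hd⟩ := exists_hasCompactSupport_primitive
    (χ := fun x => ψ x - (∫ t, ψ t) * η x) (hψ.sub (contDiff_const.mul hηs))
    (hψc.sub (hηc.mul_left)) (by
      rw [integral_sub hψi (hηi.const_mul _), integral_const_mul, hη1]; ring)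
  have h2 := h0 φ hφ hφc
  rw [hd] at h2
  have h3 : (fun x => h x * (ψ x - (∫ t, ψ t) * η x)) =
      fun x => h x * ψ x - (∫ t, ψ t) * (h x * η x) := by
    funext x; ring
  rw [h3, integral_sub (key _ hψ.continuous hψc) ((key _ hηs.continuous hηc).const_mul _),
    integral_const_mul] at h2
  simp only [smul_eq_mul]
  rw [integral_mul_const]
  have h4 : (fun x => ψ x * h x) = fun x => h x * ψ x := by funext x; ring
  rw [h4]
  linarith

/-- Integration by parts for the primitive of an integrable function. -/
theorem integral_primitive_mul_deriv {g : ℝ → ℝ} (hg : Integrable g) {φ : ℝ → ℝ}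
    (hφ : ContDiff ℝ ∞ φ) (hφc : HasCompactSupport φ) :
    ∫ x, (∫ t in Iic x, g t) * deriv φ x = -∫ x, g x * φ x := by
  have hφ' : ContDiff ℝ ∞ (deriv φ) := (contDiff_infty_iff_deriv.1 hφ).2
  have hφi : Integrable (deriv φ) :=
    hφ'.continuous.integrable_of_hasCompactSupport hφc.deriv
  have hprod : Integrable (fun p : ℝ × ℝ => {p : ℝ × ℝ | p.2 ≤ p.1}.indicator
      (fun p => deriv φ p.1 * g p.2) p) (volume.prod volume) :=
    (hφi.mul_prod hg).indicator (measurableSet_le measurable_snd measurable_fst)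
  have hswap := integral_integral_swap (f := fun x y => {p : ℝ × ℝ | p.2 ≤ p.1}.indicator
      (fun p => deriv φ p.1 * g p.2) (x, y)) hprod
  have hl : ∀ x, ∫ y, {p : ℝ × ℝ | p.2 ≤ p.1}.indicator
      (fun p => deriv φ p.1 * g p.2) (x, y) = (∫ t in Iic x, g t) * deriv φ x := by
    intro x
    rw [mul_comm, ← integral_const_mul, ← integral_indicator measurableSet_Iic]
    rfl
  have hr : ∀ y, ∫ x, {p : ℝ × ℝ | p.2 ≤ p.1}.indicator
      (fun p => deriv φ p.1 * g p.2) (x, y) = -(g y * φ y) := by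
    intro y
    have h1 : ∫ x in Ioi y, deriv φ x = - φ y :=
      hφc.integral_Ioi_deriv_eq (hφ.of_le (by norm_num)) y
    rw [mul_comm, ← neg_mul, ← h1, ← integral_Ici_eq_integral_Ioi, ← integral_mul_const,
      ← integral_indicator measurableSet_Ici]
    rfl
  simp only [hl, hr] at hswap
  rw [hswap, integral_neg]

/-- `F` is an absolutely continuous function in `W^{1,1}(ℝ)` with almost everywhere
derivative `g`. -/
structure IsACRep (F g : ℝ → ℝ) : Prop where
  continuous : Continuous F
  integrable : Integrable F volume
  integrable_deriv : Integrable g volume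
  sub_eq : ∀ a b, F b - F a = ∫ x in a..b, g x

/-- The difference between `f` and the primitive of `f'` has zero weak derivative, hence is almost
everywhere constant. -/
theorem IsW11.exists_isACRep {f f' : ℝ → ℝ} (h : IsW11 f f') :
    ∃ F, IsACRep F f' ∧ f =ᵐ[volume] F := by
  have hg := h.integrable_deriv
  have heq : ∀ x, ∫ t in Iic x, f' t = (∫ t in Iic 0, f' t) + ∫ t in (0 : ℝ)..x, f' t := by
    intro x
    rw [← intervalIntegral.integral_Iic_sub_Iic hg.integrableOn hg.integrableOn]
    ring
  have hcont : Continuous (fun x => ∫ t in Iic x, f' t) := by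
    rw [funext heq]
    exact continuous_const.add (intervalIntegral.continuous_primitive
      (fun a b => hg.intervalIntegrable) 0)
  obtain ⟨c, hc⟩ := ae_eq_const_of_integral_mul_deriv_eq_zero
    (h := fun x => f x - ∫ t in Iic x, f' t)
    (h.integrable.locallyIntegrable.sub hcont.locallyIntegrable) (by
      intro φ hφ hφc
      have hφ' : Continuous (deriv φ) := (contDiff_infty_iff_deriv.1 hφ).2.continuous
      have i1 : Integrable (fun x => f x * deriv φ x) := by
        simpa using h.integrable.locallyIntegrable.integrable_smul_right_of_hasCompactSupport
          hφ' hφc.deriv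
      have i2 : Integrable (fun x => (∫ t in Iic x, f' t) * deriv φ x) :=
        (hcont.mul hφ').integrable_of_hasCompactSupport hφc.deriv.mul_left
      simp_rw [sub_mul]
      rw [integral_sub i1 i2, integral_primitive_mul_deriv hg hφ hφc,
        h.hasWeakDeriv.integral_mul_deriv φ hφ hφc, sub_self])
  have hae : f =ᵐ[volume] fun x => (∫ t in Iic x, f' t) + c := by
    filter_upwards [hc] with x hx
    linarith
  refine ⟨fun x => (∫ t in Iic x, f' t) + c,
    ⟨hcont.add continuous_const, h.integrable.congr hae, hg, fun a b => ?_⟩, hae⟩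
  rw [← intervalIntegral.integral_Iic_sub_Iic hg.integrableOn hg.integrableOn]
  ring

theorem IsACRep.sub {F g F₁ g₁ : ℝ → ℝ} (h : IsACRep F g) (h₁ : IsACRep F₁ g₁) :
    IsACRep (F - F₁) (g - g₁) where
  continuous := h.continuous.sub h₁.continuous
  integrable := h.integrable.sub h₁.integrable
  integrable_deriv := h.integrable_deriv.sub h₁.integrable_deriv
  sub_eq a b := by
    simp only [Pi.sub_apply]
    rw [intervalIntegral.integral_sub h.integrable_deriv.intervalIntegrable
      h₁.integrable_deriv.intervalIntegrable, ← h.sub_eq, ← h₁.sub_eq]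
    ring

theorem IsACRep.abs_sub_le {F g : ℝ → ℝ} (h : IsACRep F g) {a b : ℝ} (hab : a ≤ b) :
    |F b - F a| ≤ ∫ x in Ioc a b, |g x| := by
  rw [h.sub_eq, intervalIntegral.integral_of_le hab]
  exact abs_integral_le_integral_abs

theorem IsACRep.abs_sub_le_integral {F g : ℝ → ℝ} (h : IsACRep F g) (a b : ℝ) :
    |F b - F a| ≤ ∫ x, |g x| := by
  have key : ∀ a b, a ≤ b → |F b - F a| ≤ ∫ x, |g x| := fun a b hab =>
    (h.abs_sub_le hab).trans (setIntegral_le_integral h.integrable_deriv.abs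
      (Eventually.of_forall fun x => abs_nonneg _))
  rcases le_total a b with hab | hab
  · exact key a b hab
  · rw [abs_sub_comm]; exact key b a hab

/-- The Sobolev embedding into bounded functions: `|F x| - ‖g‖₁ ≤ |F y|` is averaged over `y` in an
interval of length one. It makes uniform convergence available from `W^{1,1}` convergence. -/
theorem IsACRep.abs_le {F g : ℝ → ℝ} (h : IsACRep F g) (x : ℝ) :
    |F x| ≤ (∫ y, |F y|) + ∫ y, |g y| := by
  have h1 : ∫ y in x..(x + 1), (|F x| - ∫ z, |g z|) ≤ ∫ y in x..(x + 1), |F y| := by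
    refine intervalIntegral.integral_mono_on (by linarith) (by simp)
      h.integrable.abs.intervalIntegrable fun y _ => ?_
    have := h.abs_sub_le_integral y x
    have := abs_sub_abs_le_abs_sub (F x) (F y)
    linarith
  have h2 : ∫ y in x..(x + 1), |F y| ≤ ∫ y, |F y| := by
    rw [intervalIntegral.integral_of_le (by linarith)]
    exact setIntegral_le_integral h.integrable.abs (Eventually.of_forall fun x => abs_nonneg _)
  simp at h1
  linarith

theorem fracMaxENN_congr {β : ℝ} {f u : ℝ → ℝ} (h : ∀ᵐ y, |f y| = |u y|) :
    fracMaxENN β f = fracMaxENN β u := by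
  funext x
  unfold fracMaxENN
  have : ∀ r, ∫⁻ y in Metric.ball x r, ‖f y‖ₑ = ∫⁻ y in Metric.ball x r, ‖u y‖ₑ := by
    intro r
    refine lintegral_congr_ae (ae_restrict_of_ae ?_)
    filter_upwards [h] with y hy
    rw [← Real.enorm_abs, hy, Real.enorm_abs]
  simp only [this]

/-! ### Fractional averages, attainment of the supremum and local Lipschitz regularity. -/

/-- A nonnegative continuous integrable function bounded by `K` and with integral at most `N`. -/
structure IsProfile (u : ℝ → ℝ) (K N : ℝ) : Prop where
  continuous : Continuous u
  nonneg : ∀ y, 0 ≤ u y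
  integrable : Integrable u volume
  le : ∀ y, u y ≤ K
  integral_le : ∫ y, u y ≤ N

namespace IsProfile

variable {u : ℝ → ℝ} {K N : ℝ}

theorem K_nonneg (h : IsProfile u K N) : 0 ≤ K := (h.nonneg 0).trans (h.le 0)

theorem N_nonneg (h : IsProfile u K N) : 0 ≤ N := (integral_nonneg h.nonneg).trans h.integral_le

theorem intervalIntegrable (h : IsProfile u K N) (a b : ℝ) : IntervalIntegrable u volume a b :=
  h.integrable.intervalIntegrable

theorem integral_nonneg' (h : IsProfile u K N) {a b : ℝ} (hab : a ≤ b) :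
    0 ≤ ∫ y in a..b, u y :=
  intervalIntegral.integral_nonneg hab fun y _ => h.nonneg y

theorem integral_le_N (h : IsProfile u K N) {a b : ℝ} (hab : a ≤ b) :
    ∫ y in a..b, u y ≤ N := by
  rw [intervalIntegral.integral_of_le hab]
  exact (setIntegral_le_integral h.integrable (Eventually.of_forall h.nonneg)).trans h.integral_le

theorem integral_le_K (h : IsProfile u K N) {a b : ℝ} (hab : a ≤ b) :
    ∫ y in a..b, u y ≤ K * (b - a) := by
  have := intervalIntegral.integral_mono_on hab (h.intervalIntegrable a b)
    (by simp : IntervalIntegrable (fun _ => K) volume a b) fun y _ => h.le y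
  simpa [mul_comm] using this

theorem integral_mono_interval (h : IsProfile u K N) {a b c d : ℝ} (hca : c ≤ a) (hab : a ≤ b)
    (hbd : b ≤ d) : ∫ y in a..b, u y ≤ ∫ y in c..d, u y :=
  intervalIntegral.integral_mono_interval hca hab hbd
    (Eventually.of_forall fun y => h.nonneg y) (h.intervalIntegrable _ _)

end IsProfile

/-- The quantity `r ^ β / |B(x, r)| * ∫_{B(x, r)} u`. -/
noncomputable def fracAvg (β : ℝ) (u : ℝ → ℝ) (x r : ℝ) : ℝ :=
  r ^ (β - 1) / 2 * ∫ y in (x - r)..(x + r), u y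

/-- The radius `r` realizes the supremum in the definition of the fractional maximal function. -/
def IsOptRadius (β : ℝ) (u : ℝ → ℝ) (x r : ℝ) : Prop :=
  0 < r ∧ fracAvg β u x r = fracMax β u x

section Basic

variable {β : ℝ} {u : ℝ → ℝ} {K N : ℝ}

theorem fracAvg_nonneg (h : IsProfile u K N) (x : ℝ) {r : ℝ} (hr : 0 < r) :
    0 ≤ fracAvg β u x r := by
  have := h.integral_nonneg' (a := x - r) (b := x + r) (by linarith)
  unfold fracAvg
  positivity

theorem fracAvg_le_K (h : IsProfile u K N) (x : ℝ) {r : ℝ} (hr : 0 < r) :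
    fracAvg β u x r ≤ K * r ^ β := by
  have h1 := h.integral_le_K (a := x - r) (b := x + r) (by linarith)
  have h2 : r ^ β = r ^ (β - 1) * r := by
    rw [Real.rpow_sub_one hr.ne']; field_simp
  have h3 : 0 ≤ r ^ (β - 1) := by positivity
  unfold fracAvg
  rw [h2]
  nlinarith

theorem fracAvg_le_N (h : IsProfile u K N) (x : ℝ) {r : ℝ} (hr : 0 < r) :
    fracAvg β u x r ≤ N * r ^ (β - 1) := by
  have h1 := h.integral_le_N (a := x - r) (b := x + r) (by linarith)
  have h3 : 0 ≤ r ^ (β - 1) := by positivity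
  have := h.N_nonneg
  unfold fracAvg
  nlinarith

/-- The bound `K * r ^ β` serves for `r ≤ 1` and `N * r ^ (β - 1)` for `r ≥ 1`. -/
theorem fracAvg_le (hβ0 : 0 < β) (hβ1 : β < 1) (h : IsProfile u K N) (x : ℝ) {r : ℝ}
    (hr : 0 < r) : fracAvg β u x r ≤ K + N := by
  have hK := h.K_nonneg
  have hN := h.N_nonneg
  rcases le_total r 1 with h1 | h1
  · have := Real.rpow_le_one hr.le h1 hβ0.le
    have := fracAvg_le_K (β := β) h x hr
    nlinarith
  · have := Real.rpow_le_one_of_one_le_of_nonpos h1 (by linarith : β - 1 ≤ 0)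
    have := fracAvg_le_N (β := β) h x hr
    nlinarith

theorem fracMaxENN_term (h : IsProfile u K N) (x : ℝ) {r : ℝ} (hr : 0 < r) :
    ENNReal.ofReal (r ^ β) / volume (Metric.ball x r) * ∫⁻ y in Metric.ball x r, ‖u y‖ₑ =
      ENNReal.ofReal (fracAvg β u x r) := by
  have h1 : ∫⁻ y in Metric.ball x r, ‖u y‖ₑ = ENNReal.ofReal (∫ y in (x - r)..(x + r), u y) := by
    rw [intervalIntegral.integral_of_le (by linarith),
      integral_Ioc_eq_integral_Ioo, ← Real.ball_eq_Ioo,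
      ofReal_integral_eq_lintegral_ofReal h.integrable.integrableOn
        (Eventually.of_forall h.nonneg)]
    refine lintegral_congr fun y => ?_
    rw [Real.enorm_of_nonneg (h.nonneg y)]
  rw [h1, Real.volume_ball, ← ENNReal.ofReal_div_of_pos (by positivity),
    ← ENNReal.ofReal_mul (by positivity), fracAvg, Real.rpow_sub_one hr.ne']
  congr 1
  field_simp

theorem ofReal_fracAvg_le (h : IsProfile u K N) (x : ℝ) {r : ℝ} (hr : 0 < r) :
    ENNReal.ofReal (fracAvg β u x r) ≤ fracMaxENN β u x := by
  rw [← fracMaxENN_term h x hr]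
  exact le_iSup₂_of_le r hr.le le_rfl

theorem fracMaxENN_le (h : IsProfile u K N) {x c : ℝ}
    (hc : ∀ r, 0 < r → fracAvg β u x r ≤ c) : fracMaxENN β u x ≤ ENNReal.ofReal c := by
  refine iSup₂_le fun r hr => ?_
  rcases hr.eq_or_lt with rfl | hr
  -- The ball of radius `0` is empty, so this term vanishes whatever its prefactor.
  · simp
  · rw [fracMaxENN_term h x hr]
    exact ENNReal.ofReal_le_ofReal (hc r hr)

theorem fracMaxENN_lt_top (hβ0 : 0 < β) (hβ1 : β < 1) (h : IsProfile u K N) (x : ℝ) :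
    fracMaxENN β u x < ⊤ :=
  (fracMaxENN_le h fun _ hr => fracAvg_le hβ0 hβ1 h x hr).trans_lt ENNReal.ofReal_lt_top

theorem fracAvg_le_fracMax (hβ0 : 0 < β) (hβ1 : β < 1) (h : IsProfile u K N) (x : ℝ) {r : ℝ}
    (hr : 0 < r) : fracAvg β u x r ≤ fracMax β u x :=
  (ENNReal.ofReal_le_iff_le_toReal (fracMaxENN_lt_top hβ0 hβ1 h x).ne).1 (ofReal_fracAvg_le h x hr)

theorem fracMax_nonneg (x : ℝ) : 0 ≤ fracMax β u x := ENNReal.toReal_nonneg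

theorem fracMax_le (h : IsProfile u K N) {x c : ℝ}
    (hc : ∀ r, 0 < r → fracAvg β u x r ≤ c) : fracMax β u x ≤ c :=
  ENNReal.toReal_le_of_le_ofReal
    ((fracAvg_nonneg (β := β) h x one_pos).trans (hc 1 one_pos)) (fracMaxENN_le h hc)

/-- Radii with a not too small value of `fracAvg` are bounded above and below. -/
theorem exists_radius_bounds (hβ0 : 0 < β) (hβ1 : β < 1) {K N c : ℝ} (hK : 0 ≤ K) (hN : 0 ≤ N)
    (hc : 0 < c) : ∃ a b : ℝ, 0 < a ∧ ∀ (u : ℝ → ℝ) (x r : ℝ), IsProfile u K N → 0 < r →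
      c ≤ fracAvg β u x r → r ∈ Icc a b := by
  -- Obtained by solving `c ≤ K * r ^ β` and `c ≤ N * r ^ (β - 1)` for `r`; `K + 1` replaces `K` to
  -- avoid dividing by zero. The bounds depend on the profile only through `K` and `N`, which makes
  -- them uniform along sequences.
  refine ⟨(c / (K + 1)) ^ β⁻¹, ((N + 1) / c) ^ (1 - β)⁻¹, by positivity, ?_⟩
  intro u x r h hr hcr
  constructor
  · rw [Real.rpow_inv_le_iff_of_pos (by positivity) hr.le hβ0, div_le_iff₀ (by positivity)]
    have := fracAvg_le_K (β := β) h x hr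
    have : 0 ≤ r ^ β := by positivity
    nlinarith
  · rw [Real.le_rpow_inv_iff_of_pos hr.le (by positivity) (by linarith), le_div_iff₀ hc]
    have h1 := fracAvg_le_N (β := β) h x hr
    have h2 : r ^ (β - 1) = (r ^ (1 - β))⁻¹ := by
      rw [← Real.rpow_neg hr.le]; congr 1; ring
    have h3 : 0 < r ^ (1 - β) := by positivity
    have h4 : c ≤ N * (r ^ (1 - β))⁻¹ := by rw [← h2]; linarith
    rw [← div_eq_mul_inv, le_div_iff₀ h3] at h4
    linarith

theorem continuousAt_fracAvg (h : IsProfile u K N) (x : ℝ) {r : ℝ} (hr : 0 < r) :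
    ContinuousAt (fun p : ℝ × ℝ => fracAvg β u p.1 p.2) (x, r) := by
  have hU : Continuous fun t => ∫ y in (0 : ℝ)..t, u y :=
    intervalIntegral.continuous_primitive (fun a b => h.intervalIntegrable a b) 0
  have heq : (fun p : ℝ × ℝ => fracAvg β u p.1 p.2) = fun p => p.2 ^ (β - 1) / 2 *
      ((∫ y in (0 : ℝ)..(p.1 + p.2), u y) - ∫ y in (0 : ℝ)..(p.1 - p.2), u y) := by
    funext p
    rw [fracAvg, intervalIntegral.integral_interval_sub_left (h.intervalIntegrable _ _)
      (h.intervalIntegrable _ _)]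
  rw [heq]
  refine ContinuousAt.mul (ContinuousAt.div_const ?_ 2) ?_
  · exact ContinuousAt.rpow_const continuousAt_snd (Or.inl hr.ne')
  · exact ((hU.comp (continuous_fst.add continuous_snd)).sub
      (hU.comp (continuous_fst.sub continuous_snd))).continuousAt

/-- A lower bound of the maximal function by the mass in `[-T, T]`, uniform for `|x| ≤ R`. -/
theorem le_fracMax_of_abs_le (hβ0 : 0 < β) (hβ1 : β < 1) (h : IsProfile u K N) {R T x : ℝ}
    (hR : 0 ≤ R) (hT : 0 < T) (hx : |x| ≤ R) :
    (R + T) ^ (β - 1) / 2 * (∫ y in (-T)..T, u y) ≤ fracMax β u x := by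
  -- For `|x| ≤ R`, the ball of radius `R + T` at `x` covers `(-T, T)`.
  refine le_trans ?_ (fracAvg_le_fracMax hβ0 hβ1 h x (r := R + T) (by linarith))
  unfold fracAvg
  have hx' := abs_le.1 hx
  refine mul_le_mul_of_nonneg_left (h.integral_mono_interval ?_ ?_ ?_) (by positivity) <;> linarith

theorem exists_integral_pos (h : IsProfile u K N) (hpos : 0 < ∫ y, u y) :
    ∃ T, 0 < T ∧ 0 < ∫ y in (-T)..T, u y := by
  have ht := intervalIntegral_tendsto_integral h.integrable tendsto_neg_atTop_atBot tendsto_id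
  obtain ⟨T, hT, hT'⟩ := ((ht.eventually (lt_mem_nhds hpos)).and (eventually_gt_atTop 0)).exists
  exact ⟨T, hT', hT⟩

/-- A locally uniform positive lower bound for the maximal function. -/
theorem exists_lower_bound (hβ0 : 0 < β) (hβ1 : β < 1) (h : IsProfile u K N)
    (hpos : 0 < ∫ y, u y) {R : ℝ} (hR : 0 ≤ R) :
    ∃ c, 0 < c ∧ ∀ x, |x| ≤ R → c ≤ fracMax β u x := by
  obtain ⟨T, hT, hT'⟩ := exists_integral_pos h hpos
  exact ⟨_, by positivity, fun x hx => le_fracMax_of_abs_le hβ0 hβ1 h hR hT hx⟩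

theorem fracMax_pos (hβ0 : 0 < β) (hβ1 : β < 1) (h : IsProfile u K N) (hpos : 0 < ∫ y, u y)
    (x : ℝ) : 0 < fracMax β u x := by
  obtain ⟨c, hc, hcx⟩ := exists_lower_bound hβ0 hβ1 h hpos (abs_nonneg x)
  exact hc.trans_le (hcx x le_rfl)

/-- Radii giving at least half the supremum lie in a compact interval of positive numbers, on which
the continuous average has a maximum. -/
theorem exists_isOptRadius (hβ0 : 0 < β) (hβ1 : β < 1) (h : IsProfile u K N)
    (hpos : 0 < ∫ y, u y) (x : ℝ) : ∃ r, IsOptRadius β u x r := by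
  have hM := fracMax_pos hβ0 hβ1 h hpos x
  obtain ⟨a, b, ha, hab⟩ :=
    exists_radius_bounds hβ0 hβ1 h.K_nonneg h.N_nonneg (half_pos hM)
  have hex : ∃ r, 0 < r ∧ fracMax β u x / 2 < fracAvg β u x r := by
    by_contra! hcon
    have := fracMax_le h hcon
    linarith
  obtain ⟨r₀, hr₀, hr₀'⟩ := hex
  have hmem := hab u x r₀ h hr₀ hr₀'.le
  have hcont : ContinuousOn (fun r => fracAvg β u x r) (Icc a b) := fun r hr =>
    ((continuousAt_fracAvg h x (ha.trans_le hr.1)).comp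
      (f := fun r : ℝ => (x, r)) (by fun_prop)).continuousWithinAt
  obtain ⟨r, hr, hmax⟩ := isCompact_Icc.exists_isMaxOn ⟨r₀, hmem⟩ hcont
  have hrpos : 0 < r := ha.trans_le hr.1
  refine ⟨r, hrpos, le_antisymm (fracAvg_le_fracMax hβ0 hβ1 h x hrpos) ?_⟩
  refine fracMax_le h fun s hs => ?_
  rcases le_or_gt (fracMax β u x / 2) (fracAvg β u x s) with h1 | h1
  · exact hmax (hab u x s h hs h1)
  · exact h1.le.trans (hr₀'.le.trans (hmax hmem))

theorem fracAvg_sub_le (h : IsProfile u K N) {x y r : ℝ} (hr : 0 < r) :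
    fracAvg β u x r - fracAvg β u y r ≤ r ^ (β - 1) * K * |x - y| := by
  have hsub : (∫ t in (x - r)..(x + r), u t) - (∫ t in (y - r)..(y + r), u t) ≤ 2 * K * |x - y| := by
    have e1 := intervalIntegral.integral_add_adjacent_intervals
      (h.intervalIntegrable (x - r) (x + r)) (h.intervalIntegrable (x + r) (y + r))
    have e2 := intervalIntegral.integral_add_adjacent_intervals
      (h.intervalIntegrable (x - r) (y - r)) (h.intervalIntegrable (y - r) (y + r))
    have key : ∀ a b, |∫ t in a..b, u t| ≤ K * |b - a| := fun a b => by
      simpa using intervalIntegral.norm_integral_le_of_norm_le_const (f := u) (a := a) (b := b)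
        (C := K) fun t _ => by rw [Real.norm_of_nonneg (h.nonneg t)]; exact h.le t
    have k1 := abs_le.1 (key (x + r) (y + r))
    have k2 := abs_le.1 (key (x - r) (y - r))
    rw [show y + r - (x + r) = y - x by ring, abs_sub_comm] at k1
    rw [show y - r - (x - r) = y - x by ring, abs_sub_comm] at k2
    linarith [k1.1, k2.2]
  unfold fracAvg
  have : 0 ≤ r ^ (β - 1) := by positivity
  nlinarith

/-- The maximal function is Lipschitz where it is bounded below. -/
theorem fracMax_sub_le (hβ0 : 0 < β) (hβ1 : β < 1) (h : IsProfile u K N)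
    (hpos : 0 < ∫ y, u y) {c a b x y : ℝ} (ha : 0 < a)
    (hab : ∀ (u : ℝ → ℝ) (x r : ℝ), IsProfile u K N → 0 < r → c ≤ fracAvg β u x r → r ∈ Icc a b)
    (hx : c ≤ fracMax β u x) :
    fracMax β u x - fracMax β u y ≤ a ^ (β - 1) * K * |x - y| := by
  obtain ⟨r, hr, hrx⟩ := exists_isOptRadius hβ0 hβ1 h hpos x
  have hmem := hab u x r h hr (hrx ▸ hx)
  have h1 := fracAvg_le_fracMax hβ0 hβ1 h y hr
  have h2 := fracAvg_sub_le (β := β) h (x := x) (y := y) hr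
  have h3 : r ^ (β - 1) ≤ a ^ (β - 1) :=
    Real.rpow_le_rpow_of_nonpos ha hmem.1 (by linarith)
  have h4 : r ^ (β - 1) * K * |x - y| ≤ a ^ (β - 1) * K * |x - y| := by
    have := h.K_nonneg
    gcongr
  linarith

/-- The estimate is local: the Lipschitz constant needs a lower bound on optimal radii, which comes
from a lower bound on the maximal function on `[-R, R]`. -/
theorem exists_lipschitzOnWith_fracMax (hβ0 : 0 < β) (hβ1 : β < 1) (h : IsProfile u K N)
    (hpos : 0 < ∫ y, u y) {R : ℝ} (hR : 0 ≤ R) :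
    ∃ C, LipschitzOnWith C (fracMax β u) (Icc (-R) R) := by
  obtain ⟨c, hc, hcx⟩ := exists_lower_bound hβ0 hβ1 h hpos hR
  obtain ⟨a, b, ha, hab⟩ := exists_radius_bounds hβ0 hβ1 h.K_nonneg h.N_nonneg hc
  refine ⟨_, LipschitzOnWith.of_dist_le' (K := a ^ (β - 1) * K) fun x hx y hy => ?_⟩
  rw [Real.dist_eq, Real.dist_eq, abs_le]
  have h1 := fracMax_sub_le hβ0 hβ1 h hpos (y := y) ha hab (hcx x (abs_le.2 hx))
  have h2 := fracMax_sub_le hβ0 hβ1 h hpos (y := x) ha hab (hcx y (abs_le.2 hy))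
  rw [abs_sub_comm] at h2
  constructor <;> linarith

theorem continuous_fracMax (hβ0 : 0 < β) (hβ1 : β < 1) (h : IsProfile u K N)
    (hpos : 0 < ∫ y, u y) : Continuous (fracMax β u) := by
  rw [continuous_iff_continuousAt]
  intro x
  obtain ⟨C, hC⟩ := exists_lipschitzOnWith_fracMax hβ0 hβ1 h hpos
    (R := |x| + 1) (by positivity)
  refine hC.continuousOn.continuousAt (Icc_mem_nhds ?_ ?_)
  · linarith [neg_abs_le x]
  · linarith [le_abs_self x]

theorem ae_differentiableAt_fracMax (hβ0 : 0 < β) (hβ1 : β < 1) (h : IsProfile u K N)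
    (hpos : 0 < ∫ y, u y) : ∀ᵐ x, DifferentiableAt ℝ (fracMax β u) x := by
  have key : ∀ n : ℕ, ∀ᵐ x, x ∈ Ioo (-(n : ℝ)) n → DifferentiableAt ℝ (fracMax β u) x := by
    intro n
    obtain ⟨C, hC⟩ := exists_lipschitzOnWith_fracMax hβ0 hβ1 h hpos (R := n) (by positivity)
    filter_upwards [hC.ae_differentiableWithinAt_of_mem_real] with x hx hxn
    exact (hx (Ioo_subset_Icc_self hxn)).differentiableAt (Icc_mem_nhds hxn.1 hxn.2)
  filter_upwards [ae_all_iff.2 key] with x hx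
  obtain ⟨n, hn⟩ := exists_nat_gt |x|
  exact hx n (abs_lt.1 hn)

end Basic

/-! ### Optimality conditions, comparison of optimal radii and measurable selection. -/

section OptRadius

variable {β : ℝ} {u : ℝ → ℝ} {K N : ℝ}

theorem hasDerivAt_fracAvg_center (h : IsProfile u K N) (x r : ℝ) :
    HasDerivAt (fun y => fracAvg β u y r) (r ^ (β - 1) / 2 * (u (x + r) - u (x - r))) x := by
  have hU : ∀ t, HasDerivAt (fun t => ∫ y in (0 : ℝ)..t, u y) (u t) t := fun t =>
    intervalIntegral.integral_hasDerivAt_right (h.intervalIntegrable _ _)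
      (h.continuous.stronglyMeasurableAtFilter _ _) h.continuous.continuousAt
  have heq : (fun y => fracAvg β u y r) = fun y => r ^ (β - 1) / 2 *
      ((∫ t in (0 : ℝ)..(y + r), u t) - ∫ t in (0 : ℝ)..(y - r), u t) := by
    funext y
    rw [fracAvg, intervalIntegral.integral_interval_sub_left (h.intervalIntegrable _ _)
      (h.intervalIntegrable _ _)]
  rw [heq]
  exact (((hU (x + r)).comp_add_const x r).sub ((hU (x - r)).comp_sub_const x r)).const_mul _

theorem hasDerivAt_fracAvg_radius (h : IsProfile u K N) (x : ℝ) {r : ℝ} (hr : 0 < r) :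
    HasDerivAt (fun s => fracAvg β u x s)
      ((β - 1) * r ^ (β - 1 - 1) / 2 * (∫ y in (x - r)..(x + r), u y) +
        r ^ (β - 1) / 2 * (u (x + r) + u (x - r))) r := by
  have hU : ∀ t, HasDerivAt (fun t => ∫ y in (0 : ℝ)..t, u y) (u t) t := fun t =>
    intervalIntegral.integral_hasDerivAt_right (h.intervalIntegrable _ _)
      (h.continuous.stronglyMeasurableAtFilter _ _) h.continuous.continuousAt
  have hI : ∀ s, (∫ y in (x - s)..(x + s), u y) =
      (∫ t in (0 : ℝ)..(x + s), u t) - ∫ t in (0 : ℝ)..(x - s), u t := fun s => by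
    rw [intervalIntegral.integral_interval_sub_left (h.intervalIntegrable _ _)
      (h.intervalIntegrable _ _)]
  have hd : HasDerivAt (fun s => ∫ y in (x - s)..(x + s), u y) (u (x + r) + u (x - r)) r := by
    simp_rw [hI]
    have := ((hU (x + r)).comp_const_add x r).sub ((hU (x - r)).comp_const_sub x r)
    rwa [sub_neg_eq_add] at this
  have hp : HasDerivAt (fun s : ℝ => s ^ (β - 1) / 2) ((β - 1) * r ^ (β - 1 - 1) / 2) r :=
    (Real.hasDerivAt_rpow_const (Or.inl hr.ne')).div_const 2
  exact hp.mul hd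

/-- The first-order condition for the maximum over the radius. -/
theorem IsOptRadius.add_eq (hβ0 : 0 < β) (hβ1 : β < 1) (h : IsProfile u K N) {x r : ℝ}
    (hr : IsOptRadius β u x r) :
    u (x + r) + u (x - r) = (1 - β) / r * ∫ y in (x - r)..(x + r), u y := by
  have hr0 := hr.1
  have hmax : IsLocalMax (fun s => fracAvg β u x s) r := by
    filter_upwards [lt_mem_nhds hr0] with s hs
    rw [hr.2]
    exact fracAvg_le_fracMax hβ0 hβ1 h x hs
  have h0 := hmax.hasDerivAt_eq_zero (hasDerivAt_fracAvg_radius h x hr0)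
  rw [Real.rpow_sub_one hr0.ne' (β - 1)] at h0
  have hp : 0 < r ^ (β - 1) := by positivity
  have h1 : r ^ (β - 1) / 2 * ((u (x + r) + u (x - r)) -
      (1 - β) / r * ∫ y in (x - r)..(x + r), u y) = 0 := by
    rw [← h0]; field_simp; ring
  rcases mul_eq_zero.1 h1 with h2 | h2
  · linarith
  · linarith

/-- With `r` frozen, `y ↦ fracAvg β u y r` touches the maximal function from below at `x`, so the
two derivatives agree there. No regularity of the optimal radius in `x` is needed. -/
theorem IsOptRadius.deriv_eq (hβ0 : 0 < β) (hβ1 : β < 1) (h : IsProfile u K N) {x r : ℝ}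
    (hr : IsOptRadius β u x r) (hd : DifferentiableAt ℝ (fracMax β u) x) :
    deriv (fracMax β u) x = r ^ (β - 1) / 2 * (u (x + r) - u (x - r)) := by
  have hmin : IsLocalMin (fun y => fracMax β u y - fracAvg β u y r) x := by
    refine Eventually.of_forall fun y => ?_
    simp only [hr.2, sub_self, sub_nonneg]
    exact fracAvg_le_fracMax hβ0 hβ1 h y hr.1
  have h0 := hmin.hasDerivAt_eq_zero (hd.hasDerivAt.sub (hasDerivAt_fracAvg_center h x r))
  linarith

/-- The mean value of `u` over the ball `B(x, r)`. -/
noncomputable def ballAvg (u : ℝ → ℝ) (x r : ℝ) : ℝ := (∫ y in (x - r)..(x + r), u y) / (2 * r)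

theorem fracAvg_eq_rpow_mul_ballAvg (x : ℝ) {r : ℝ} (hr : 0 < r) :
    fracAvg β u x r = r ^ β * ballAvg u x r := by
  rw [fracAvg, ballAvg, Real.rpow_sub_one hr.ne']
  field_simp

theorem ballAvg_nonneg (h : IsProfile u K N) (x : ℝ) {r : ℝ} (hr : 0 < r) :
    0 ≤ ballAvg u x r :=
  div_nonneg (h.integral_nonneg' (by linarith)) (by linarith)

theorem ballAvg_le_N (h : IsProfile u K N) (x : ℝ) {r : ℝ} (hr : 0 < r) :
    ballAvg u x r ≤ N / (2 * r) := by
  unfold ballAvg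
  have := h.integral_le_N (a := x - r) (b := x + r) (by linarith)
  gcongr

theorem ballAvg_le_K (h : IsProfile u K N) (x : ℝ) {r : ℝ} (hr : 0 < r) :
    ballAvg u x r ≤ K := by
  unfold ballAvg
  rw [div_le_iff₀ (by positivity)]
  have := h.integral_le_K (a := x - r) (b := x + r) (by linarith)
  linarith

theorem IsOptRadius.ballAvg_pos {x r : ℝ} (hr : IsOptRadius β u x r)
    (hM : 0 < fracMax β u x) : 0 < ballAvg u x r := by
  rw [← hr.2, fracAvg_eq_rpow_mul_ballAvg x hr.1] at hM
  have := Real.rpow_pos_of_pos hr.1 β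
  exact pos_of_mul_pos_right hM this.le

theorem IsOptRadius.add_eq_ballAvg (hβ0 : 0 < β) (hβ1 : β < 1) (h : IsProfile u K N) {x r : ℝ}
    (hr : IsOptRadius β u x r) : u (x + r) + u (x - r) = 2 * (1 - β) * ballAvg u x r := by
  rw [hr.add_eq hβ0 hβ1 h, ballAvg]
  have := hr.1
  field_simp

theorem IsOptRadius.abs_deriv_le (hβ0 : 0 < β) (hβ1 : β < 1) (h : IsProfile u K N) {x r : ℝ}
    (hr : IsOptRadius β u x r) :
    |deriv (fracMax β u) x| ≤ (1 - β) * r ^ (β - 1) * ballAvg u x r := by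
  have hr0 := hr.1
  have hp : 0 < r ^ (β - 1) := by positivity
  have ha := ballAvg_nonneg h x hr0
  by_cases hd : DifferentiableAt ℝ (fracMax β u) x
  · rw [hr.deriv_eq hβ0 hβ1 h hd, abs_mul, abs_of_pos (by positivity)]
    have h1 : |u (x + r) - u (x - r)| ≤ 2 * (1 - β) * ballAvg u x r := by
      rw [← hr.add_eq_ballAvg hβ0 hβ1 h, abs_le]
      constructor <;> linarith [h.nonneg (x + r), h.nonneg (x - r)]
    calc r ^ (β - 1) / 2 * |u (x + r) - u (x - r)|
        ≤ r ^ (β - 1) / 2 * (2 * (1 - β) * ballAvg u x r) := by gcongr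
      _ = _ := by ring
  -- Here `deriv` has its default value `0`, so the bound holds at every point and not only almost
  -- everywhere.
  · rw [deriv_zero_of_not_differentiableAt hd, abs_zero]
    have : 0 < 1 - β := by linarith
    positivity

/-- The factor by which the radii of two optimal balls with a common point and a common level of
`u` can differ. -/
noncomputable def radiusRatio (β : ℝ) : ℝ := (2 * 3 ^ (1 - β)) ^ β⁻¹

theorem one_le_radiusRatio (hβ0 : 0 < β) (hβ1 : β < 1) : 1 ≤ radiusRatio β := by
  refine Real.one_le_rpow ?_ (by positivity)
  have : (1 : ℝ) ≤ 3 ^ (1 - β) := Real.one_le_rpow (by norm_num) (by linarith)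
  linarith

/-- If `r' > r`, the ball at `x` of radius `r + 2 * r' ≤ 3 * r'` contains the ball at `x'`.
Maximality at `x` then forces `(3 * r') ^ (β - 1) * r' * a' ≤ r ^ β * a`, with `a`, `a'` the two
means; together with `a ≤ 2 * a'` this bounds `r' / r`. -/
theorem IsOptRadius.le_radiusRatio_mul (hβ0 : 0 < β) (hβ1 : β < 1) (h : IsProfile u K N)
    {x r x' r' y : ℝ} (hr : IsOptRadius β u x r) (hr' : IsOptRadius β u x' r')
    (hM : 0 < fracMax β u x') (hy : |x - y| < r) (hy' : |x' - y| < r')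
    (ha : ballAvg u x r ≤ 2 * ballAvg u x' r') : r' ≤ radiusRatio β * r := by
  have hr0 := hr.1
  have hr0' := hr'.1
  have hρ := one_le_radiusRatio hβ0 hβ1
  rcases le_or_gt r' r with hle | hlt
  · nlinarith
  have ha' := hr'.ballAvg_pos hM
  have h1 := fracAvg_le_fracMax hβ0 hβ1 h x (r := r + 2 * r') (by linarith)
  rw [← hr.2, fracAvg_eq_rpow_mul_ballAvg x hr0, fracAvg] at h1
  have hI : 2 * r' * ballAvg u x' r' ≤ ∫ t in (x - (r + 2 * r'))..(x + (r + 2 * r')), u t := by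
    have : 2 * r' * ballAvg u x' r' = ∫ t in (x' - r')..(x' + r'), u t := by
      rw [ballAvg]; field_simp
    rw [this]
    have i1 := abs_lt.1 hy
    have i2 := abs_lt.1 hy'
    apply h.integral_mono_interval <;> linarith
  have hp : (3 * r') ^ (β - 1) ≤ (r + 2 * r') ^ (β - 1) :=
    Real.rpow_le_rpow_of_nonpos (by linarith) (by linarith) (by linarith)
  have h2 : (3 * r') ^ (β - 1) / 2 * (2 * r' * ballAvg u x' r') ≤
      r ^ β * (2 * ballAvg u x' r') := by
    refine le_trans ?_ (h1.trans (mul_le_mul_of_nonneg_left ha (by positivity)))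
    gcongr
  have h3 : (3 * r') ^ (β - 1) * r' ≤ 2 * r ^ β := by
    refine le_of_mul_le_mul_right ?_ ha'
    linarith
  have h4 : r' ^ β = r' ^ (β - 1) * r' := by
    rw [Real.rpow_sub_one hr0'.ne']; field_simp
  have h5 : (3 : ℝ) ^ (1 - β) * 3 ^ (β - 1) = 1 := by
    rw [← Real.rpow_add (by norm_num)]; simp
  rw [Real.mul_rpow (by norm_num) hr0'.le] at h3
  have h6 : r' ^ β ≤ (2 * 3 ^ (1 - β)) * r ^ β := by
    have hq : (0 : ℝ) ≤ 3 ^ (1 - β) := by positivity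
    calc r' ^ β = (3 : ℝ) ^ (1 - β) * (3 ^ (β - 1) * r' ^ (β - 1) * r') := by
          rw [h4]; linear_combination -(r' ^ (β - 1) * r') * h5
      _ ≤ 3 ^ (1 - β) * (2 * r ^ β) := by gcongr
      _ = _ := by ring
  have h7 : radiusRatio β ^ β = 2 * 3 ^ (1 - β) :=
    Real.rpow_inv_rpow (by positivity) hβ0.ne'
  rw [← h7, ← Real.mul_rpow (by linarith) hr0.le] at h6
  exact (Real.rpow_le_rpow_iff hr0'.le (by positivity) hβ0).1 h6

/-- A limit of optimal radii is an optimal radius. -/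
theorem exists_subseq_isOptRadius (hβ0 : 0 < β) (hβ1 : β < 1) {v : ℕ → ℝ → ℝ} {ξ ρ η : ℕ → ℝ}
    (hv : ∀ n, IsProfile (v n) K N) (h : IsProfile u K N) {x : ℝ} (hξ : Tendsto ξ atTop (𝓝 x))
    (hη : Tendsto η atTop (𝓝 0))
    (hvu : ∀ n y r, 0 < r → |fracAvg β (v n) y r - fracAvg β u y r| ≤ η n)
    (hM : Tendsto (fun n => fracMax β (v n) (ξ n)) atTop (𝓝 (fracMax β u x)))
    (hpos : 0 < fracMax β u x) (hρ : ∀ n, IsOptRadius β (v n) (ξ n) (ρ n)) :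
    ∃ r, IsOptRadius β u x r ∧ ∃ φ : ℕ → ℕ, StrictMono φ ∧ Tendsto (ρ ∘ φ) atTop (𝓝 r) := by
  obtain ⟨a, b, ha, hab⟩ :=
    exists_radius_bounds hβ0 hβ1 h.K_nonneg h.N_nonneg (half_pos hpos)
  have hev : ∀ᶠ n in atTop, ρ n ∈ Icc a b := by
    filter_upwards [hM.eventually (lt_mem_nhds (half_lt_self hpos))] with n hn
    exact hab (v n) (ξ n) (ρ n) (hv n) (hρ n).1 ((hρ n).2 ▸ hn.le)
  obtain ⟨r, hr, φ, hφ, hlim⟩ := isCompact_Icc.tendsto_subseq' hev.frequently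
  have hr0 : 0 < r := ha.trans_le hr.1
  refine ⟨r, ⟨hr0, ?_⟩, φ, hφ, hlim⟩
  have hφt := hφ.tendsto_atTop
  have h1 : Tendsto (fun n => fracAvg β u (ξ (φ n)) (ρ (φ n))) atTop (𝓝 (fracAvg β u x r)) :=
    (continuousAt_fracAvg (β := β) h x hr0).tendsto.comp
      ((hξ.comp hφt).prodMk_nhds hlim)
  have h2 : Tendsto (fun n => fracAvg β (v (φ n)) (ξ (φ n)) (ρ (φ n)) -
      fracAvg β u (ξ (φ n)) (ρ (φ n))) atTop (𝓝 0) :=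
    squeeze_zero_norm (fun n => hvu _ _ _ (hρ _).1) (hη.comp hφt)
  have h3 : Tendsto (fun n => fracMax β (v (φ n)) (ξ (φ n))) atTop (𝓝 (0 + fracAvg β u x r)) :=
    (h2.add h1).congr fun n => by rw [sub_add_cancel, (hρ (φ n)).2]
  rw [zero_add] at h3
  exact tendsto_nhds_unique h3 (hM.comp hφt)

/-- The largest optimal radius. -/
noncomputable def optRadius (β : ℝ) (u : ℝ → ℝ) (x : ℝ) : ℝ := sSup {r | IsOptRadius β u x r}

theorem le_optRadius (hβ0 : 0 < β) (hβ1 : β < 1) (h : IsProfile u K N) (hpos : 0 < ∫ y, u y)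
    {x r : ℝ} (hr : IsOptRadius β u x r) : r ≤ optRadius β u x := by
  obtain ⟨a, b, ha, hab⟩ := exists_radius_bounds hβ0 hβ1 h.K_nonneg h.N_nonneg
    (fracMax_pos hβ0 hβ1 h hpos x)
  exact le_csSup ⟨b, fun s hs => (hab u x s h hs.1 hs.2.ge).2⟩ hr

/-- The set of optimal radii is bounded, and closed by `exists_subseq_isOptRadius` applied to
constant sequences. -/
theorem isOptRadius_optRadius (hβ0 : 0 < β) (hβ1 : β < 1) (h : IsProfile u K N)
    (hpos : 0 < ∫ y, u y) (x : ℝ) : IsOptRadius β u x (optRadius β u x) := by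
  obtain ⟨a, b, ha, hab⟩ := exists_radius_bounds hβ0 hβ1 h.K_nonneg h.N_nonneg
    (fracMax_pos hβ0 hβ1 h hpos x)
  have hbdd : BddAbove {r | IsOptRadius β u x r} :=
    ⟨b, fun s hs => (hab u x s h hs.1 hs.2.ge).2⟩
  refine IsClosed.csSup_mem ?_ (exists_isOptRadius hβ0 hβ1 h hpos x) hbdd
  refine IsSeqClosed.isClosed fun ρ r hρ hlim => ?_
  obtain ⟨s, hs, φ, hφ, hsl⟩ := exists_subseq_isOptRadius (v := fun _ => u) (ξ := fun _ => x)
    (η := fun _ => 0) hβ0 hβ1 (fun _ => h) h tendsto_const_nhds tendsto_const_nhds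
    (fun n y r _ => by simp) tendsto_const_nhds (fracMax_pos hβ0 hβ1 h hpos x) hρ
  have := tendsto_nhds_unique hsl (hlim.comp hφ.tendsto_atTop)
  exact this ▸ hs

/-- Choosing the largest optimal radius makes the selection upper semicontinuous: limits of optimal
radii are optimal, so superlevel sets are closed. -/
theorem measurable_optRadius (hβ0 : 0 < β) (hβ1 : β < 1) (h : IsProfile u K N)
    (hpos : 0 < ∫ y, u y) : Measurable (optRadius β u) := by
  refine measurable_of_Ici fun a => IsClosed.measurableSet ?_
  refine IsSeqClosed.isClosed fun ξ x hξ hlim => ?_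
  obtain ⟨s, hs, φ, hφ, hsl⟩ := exists_subseq_isOptRadius (v := fun _ => u) (ξ := ξ)
    (ρ := fun n => optRadius β u (ξ n))
    (η := fun _ => 0) hβ0 hβ1 (fun _ => h) h hlim tendsto_const_nhds
    (fun n y r _ => by simp)
    (((continuous_fracMax hβ0 hβ1 h hpos).tendsto x).comp hlim)
    (fracMax_pos hβ0 hβ1 h hpos x) (fun n => isOptRadius_optRadius hβ0 hβ1 h hpos (ξ n))
  exact (ge_of_tendsto' hsl fun n => hξ (φ n)).trans (le_optRadius hβ0 hβ1 h hpos hs)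

end OptRadius

/-! ### Variation of `F` inside a strip of levels. -/

section Variation

/-- A continuous function taking values `≤ s` and `≥ t` crosses the strip between the two levels. -/
theorem exists_crossing_of_le {w : ℝ → ℝ} (hw : Continuous w) {p q s t : ℝ} (hpq : p ≤ q)
    (hp : w p ≤ s) (hq : t ≤ w q) :
    ∃ a b, p ≤ a ∧ a ≤ b ∧ b ≤ q ∧ (∀ x ∈ Ioo a b, w x ∈ Icc s t) ∧ w a ≤ s ∧ t ≤ w b := by
  -- `a` is the last point of `[p, q]` where `w ≤ s`, and `b` the first point after `a` where `t ≤
  -- w`; in between neither inequality can hold.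
  obtain ⟨a, ⟨⟨hpa, haq⟩, has⟩, hamax⟩ :=
    (isCompact_Icc.inter_right (isClosed_le hw continuous_const) :
      IsCompact (Icc p q ∩ {x | w x ≤ s})).exists_isGreatest ⟨p, ⟨le_rfl, hpq⟩, hp⟩
  obtain ⟨b, ⟨⟨hab, hbq⟩, hbt⟩, hbmin⟩ :=
    (isCompact_Icc.inter_right (isClosed_le continuous_const hw) :
      IsCompact (Icc a q ∩ {x | t ≤ w x})).exists_isLeast ⟨q, ⟨haq, le_rfl⟩, hq⟩
  refine ⟨a, b, hpa, hab, hbq, fun x hx => ⟨?_, ?_⟩, has, hbt⟩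
  · by_contra! hlt
    have := hamax ⟨⟨hpa.trans hx.1.le, hx.2.le.trans hbq⟩, hlt.le⟩
    linarith [hx.1]
  · by_contra! hlt
    have := hbmin ⟨⟨hx.1.le, hx.2.le.trans hbq⟩, hlt.le⟩
    linarith [hx.2]

theorem exists_crossing {w : ℝ → ℝ} (hw : Continuous w) {l m p q s t : ℝ} (hp' : p ∈ Icc l m)
    (hq' : q ∈ Icc l m) (hp : w p ≤ s) (hq : t ≤ w q) :
    ∃ a b, l ≤ a ∧ a ≤ b ∧ b ≤ m ∧ (∀ x ∈ Ioo a b, w x ∈ Icc s t) ∧ t - s ≤ |w b - w a| := by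
  rcases le_total p q with hpq | hpq
  · obtain ⟨a, b, h1, h2, h3, h4, h5, h6⟩ := exists_crossing_of_le hw hpq hp hq
    exact ⟨a, b, hp'.1.trans h1, h2, h3.trans hq'.2, h4, le_trans (by linarith) (le_abs_self _)⟩
  · obtain ⟨a, b, h1, h2, h3, h4, h5, h6⟩ := exists_crossing_of_le (w := fun x => w (-x))
      (hw.comp continuous_neg) (neg_le_neg hpq) (by simpa using hp) (by simpa using hq)
    refine ⟨-b, -a, by linarith [hq'.1], by linarith, by linarith [hp'.2], fun x hx => ?_, ?_⟩
    · simpa using h4 (-x) ⟨by linarith [hx.2], by linarith [hx.1]⟩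
    · rw [abs_sub_comm]
      exact le_trans (by linarith) (le_abs_self _)

theorem IsACRep.sub_le_integral_strip {F g : ℝ → ℝ} (h : IsACRep F g) {l m p q s t : ℝ}
    (hp' : p ∈ Icc l m) (hq' : q ∈ Icc l m) (hp : |F p| ≤ s) (hq : t ≤ |F q|) :
    t - s ≤ ∫ y in Ioo l m ∩ {y | |F y| ∈ Icc s t}, |g y| := by
  obtain ⟨a, b, h1, h2, h3, h4, h5⟩ :=
    exists_crossing (w := fun x => |F x|) h.continuous.abs hp' hq' hp hq
  calc t - s ≤ |F b - F a| := h5.trans (abs_abs_sub_abs_le_abs_sub _ _)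
    _ ≤ ∫ y in Ioc a b, |g y| := h.abs_sub_le h2
    _ = ∫ y in Ioo a b, |g y| := integral_Ioc_eq_integral_Ioo
    _ ≤ _ := by
      refine setIntegral_mono_set h.integrable_deriv.abs.integrableOn
        (Eventually.of_forall fun y => abs_nonneg _) (LE.le.eventuallyLE ?_)
      exact fun y hy => ⟨⟨h1.trans_lt hy.1, hy.2.trans_le h3⟩, h4 y hy⟩

theorem IsProfile.exists_ballAvg_le {u : ℝ → ℝ} {K N : ℝ} (h : IsProfile u K N) (x : ℝ) {r : ℝ}
    (hr : 0 < r) : ∃ y ∈ Icc (x - r) (x + r), ballAvg u x r ≤ u y := by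
  obtain ⟨y, hy, hmax⟩ := isCompact_Icc.exists_isMaxOn
    (nonempty_Icc.2 (by linarith : x - r ≤ x + r)) h.continuous.continuousOn
  refine ⟨y, hy, ?_⟩
  have := intervalIntegral.integral_mono_on (by linarith : x - r ≤ x + r)
    (h.intervalIntegrable _ _) (by simp : IntervalIntegrable (fun _ => u y) volume _ _)
    fun z hz => hmax hz
  rw [ballAvg, div_le_iff₀ (by positivity)]
  simp at this
  linarith

/-- On an optimal ball, the function varies by a multiple of its mean, inside a strip of levels
comparable to the mean. -/
theorem IsOptRadius.ballAvg_le_integral {β : ℝ} (hβ0 : 0 < β) (hβ1 : β < 1) {F g : ℝ → ℝ}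
    {K N : ℝ} (hF : IsACRep F g) (h : IsProfile (fun y => |F y|) K N) {x r : ℝ}
    (hr : IsOptRadius β (fun y => |F y|) x r) (hM : 0 < fracMax β (fun y => |F y|) x) :
    β / 2 * ballAvg (fun y => |F y|) x r ≤ ∫ y in Ioo (x - r) (x + r) ∩
      {y | |F y| ∈ Icc ((1 - β / 2) * ballAvg (fun y => |F y|) x r)
        (ballAvg (fun y => |F y|) x r)}, |g y| := by
  have hr0 := hr.1
  have ha := hr.ballAvg_pos hM
  have hsum := hr.add_eq_ballAvg hβ0 hβ1 h
  set a := ballAvg (fun y => |F y|) x r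
  obtain ⟨q, hq, hq'⟩ := h.exists_ballAvg_le x hr0
  -- Otherwise the two endpoint values would add up to more than `(2 - β) * a`, but their sum is `2
  -- * (1 - β) * a`.
  have hp : ∃ p ∈ Icc (x - r) (x + r), |F p| ≤ (1 - β / 2) * a := by
    by_contra! hcon
    have h1 := hcon (x + r) ⟨by linarith, le_rfl⟩
    have h2 := hcon (x - r) ⟨le_rfl, by linarith⟩
    nlinarith
  obtain ⟨p, hp, hp'⟩ := hp
  have := hF.sub_le_integral_strip hp hq hp' hq'
  linarith

end Variation

/-! ### Exchange of integrals over the strips and the localized endpoint bound. -/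

section StripBound

variable {β : ℝ} {F g : ℝ → ℝ} {K N : ℝ}

/-- The mean of `u` over the largest optimal ball centered at `x`. -/
noncomputable def optAvg (β : ℝ) (u : ℝ → ℝ) (x : ℝ) : ℝ := ballAvg u x (optRadius β u x)

theorem measurable_optAvg {u : ℝ → ℝ} (hβ0 : 0 < β) (hβ1 : β < 1) (h : IsProfile u K N)
    (hpos : 0 < ∫ y, u y) : Measurable (optAvg β u) := by
  have hU : Continuous fun t => ∫ y in (0 : ℝ)..t, u y :=
    intervalIntegral.continuous_primitive (fun a b => h.intervalIntegrable a b) 0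
  have hR := measurable_optRadius hβ0 hβ1 h hpos
  have heq : optAvg β u = fun x => ((∫ y in (0 : ℝ)..(x + optRadius β u x), u y) -
      ∫ y in (0 : ℝ)..(x - optRadius β u x), u y) / (2 * optRadius β u x) := by
    funext x
    rw [optAvg, ballAvg, intervalIntegral.integral_interval_sub_left (h.intervalIntegrable _ _)
      (h.intervalIntegrable _ _)]
  rw [heq]
  exact ((hU.measurable.comp (measurable_id.add hR)).sub
    (hU.measurable.comp (measurable_id.sub hR))).div (hR.const_mul 2)

/-- The pairs `(x, y)` such that `y` lies in the optimal ball at `x` and `u y` is comparable to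
the mean over that ball. -/
def stripSet (β : ℝ) (u : ℝ → ℝ) : Set (ℝ × ℝ) :=
  {p | |p.1 - p.2| < optRadius β u p.1 ∧
    (1 - β / 2) * optAvg β u p.1 ≤ u p.2 ∧ u p.2 ≤ optAvg β u p.1}

theorem measurableSet_stripSet {u : ℝ → ℝ} (hβ0 : 0 < β) (hβ1 : β < 1) (h : IsProfile u K N)
    (hpos : 0 < ∫ y, u y) : MeasurableSet (stripSet β u) := by
  have hR : Measurable fun p : ℝ × ℝ => optRadius β u p.1 :=
    (measurable_optRadius hβ0 hβ1 h hpos).comp measurable_fst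
  have ha : Measurable fun p : ℝ × ℝ => optAvg β u p.1 :=
    (measurable_optAvg hβ0 hβ1 h hpos).comp measurable_fst
  have hu : Measurable fun p : ℝ × ℝ => u p.2 := h.continuous.measurable.comp measurable_snd
  exact (measurableSet_lt ((measurable_fst.sub measurable_snd).abs) hR).inter
    ((measurableSet_le (ha.const_mul _) hu).inter (measurableSet_le hu ha))

/-- For fixed `y`, the optimal balls at the points `x` with `(x, y) ∈ stripSet β u` have comparable
radii. -/
theorem lintegral_stripSet_le {u : ℝ → ℝ} (hβ0 : 0 < β) (hβ1 : β < 1) (h : IsProfile u K N)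
    (hpos : 0 < ∫ y, u y) (y : ℝ) :
    ∫⁻ x, {x | (x, y) ∈ stripSet β u}.indicator
      (fun x => ENNReal.ofReal (optRadius β u x)⁻¹) x ≤
      ENNReal.ofReal (2 * radiusRatio β ^ 2) := by
  have hopt := isOptRadius_optRadius hβ0 hβ1 h hpos
  have hρ := one_le_radiusRatio hβ0 hβ1
  rcases {x | (x, y) ∈ stripSet β u}.eq_empty_or_nonempty with hE | ⟨x₀, hx₀⟩
  · simp [hE]
  set ρ := radiusRatio β
  set r₀ := optRadius β u x₀
  have hr₀ : 0 < r₀ := (hopt x₀).1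
  have key : ∀ x x', (x, y) ∈ stripSet β u → (x', y) ∈ stripSet β u →
      optRadius β u x' ≤ ρ * optRadius β u x := by
    intro x x' hx hx'
    refine (hopt x).le_radiusRatio_mul hβ0 hβ1 h (hopt x') (fracMax_pos hβ0 hβ1 h hpos x')
      hx.1 hx'.1 ?_
    -- Both strips contain the level `u y`; since `1 - β / 2 ≥ 1 / 2`, the means agree up to a
    -- factor `2`, as the radius comparison requires.
    have h1 : (1 - β / 2) * optAvg β u x ≤ optAvg β u x' := hx.2.1.trans hx'.2.2
    have h2 : 0 ≤ optAvg β u x := ballAvg_nonneg h x (hopt x).1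
    change optAvg β u x ≤ 2 * optAvg β u x'
    nlinarith
  -- With one admissible `x₀` fixed, every other admissible point has radius between `r₀ / ρ` and `ρ
  -- * r₀`, hence lies within `ρ * r₀` of `y`.
  calc _ ≤ ∫⁻ x, (Metric.ball y (ρ * r₀)).indicator (fun _ => ENNReal.ofReal (ρ / r₀)) x := by
        refine lintegral_mono fun x => ?_
        by_cases hx : (x, y) ∈ stripSet β u
        · have hk := key x₀ x hx₀ hx
          have hk' := key x x₀ hx hx₀
          have hRx := (hopt x).1
          have hmem : x ∈ Metric.ball y (ρ * r₀) := by
            rw [Metric.mem_ball, Real.dist_eq]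
            exact hx.1.trans_le hk
          rw [indicator_of_mem (show x ∈ {x | (x, y) ∈ stripSet β u} from hx),
            indicator_of_mem hmem]
          refine ENNReal.ofReal_le_ofReal ?_
          rw [inv_le_iff_one_le_mul₀ hRx, div_mul_eq_mul_div, le_div_iff₀ hr₀]
          linarith
        · rw [indicator_of_notMem (show x ∉ {x | (x, y) ∈ stripSet β u} from hx)]
          exact zero_le
    _ = ENNReal.ofReal (ρ / r₀) * ENNReal.ofReal (2 * (ρ * r₀)) := by
        rw [lintegral_indicator_const measurableSet_ball, Real.volume_ball]
    _ = ENNReal.ofReal (2 * ρ ^ 2) := by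
        rw [← ENNReal.ofReal_mul (by positivity)]
        congr 1
        field_simp

/-- Tonelli's theorem, with the `x`-integral bounded by `lintegral_stripSet_le`. Restricting `x` to
`A` and `y` to `S` is what later permits tail estimates. -/
theorem lintegral_optRadius_inv_le (hβ0 : 0 < β) (hβ1 : β < 1) {u : ℝ → ℝ} (h : IsProfile u K N)
    (hpos : 0 < ∫ y, u y) (hg : Integrable g) {A S : Set ℝ} (hA : MeasurableSet A)
    (hS : MeasurableSet S) (hAS : ∀ x ∈ A, ∀ y, (x, y) ∈ stripSet β u → y ∈ S) :
    ∫⁻ x in A, ∫⁻ y, (stripSet β u).indicator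
      (fun p => ENNReal.ofReal (optRadius β u p.1)⁻¹ * ‖g p.2‖ₑ) (x, y) ≤
      ENNReal.ofReal (2 * radiusRatio β ^ 2) * ∫⁻ y in S, ‖g y‖ₑ := by
  have hR := measurable_optRadius hβ0 hβ1 h hpos
  have hP := measurableSet_stripSet hβ0 hβ1 h hpos
  rw [lintegral_lintegral_swap]
  · rw [← lintegral_const_mul'' _ hg.aestronglyMeasurable.enorm.restrict,
      ← lintegral_indicator hS]
    refine lintegral_mono fun y => ?_
    by_cases hy : y ∈ S
    · rw [indicator_of_mem hy]
      refine (setLIntegral_le_lintegral A _).trans ?_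
      have : ∀ x, (stripSet β u).indicator
          (fun p => ENNReal.ofReal (optRadius β u p.1)⁻¹ * ‖g p.2‖ₑ) (x, y) =
          {x | (x, y) ∈ stripSet β u}.indicator
            (fun x => ENNReal.ofReal (optRadius β u x)⁻¹) x * ‖g y‖ₑ := by
        intro x
        by_cases hx : (x, y) ∈ stripSet β u
        · rw [indicator_of_mem hx, indicator_of_mem (show x ∈ {x | (x, y) ∈ stripSet β u} from hx)]
        · rw [indicator_of_notMem hx,
            indicator_of_notMem (show x ∉ {x | (x, y) ∈ stripSet β u} from hx), zero_mul]
      simp_rw [this]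
      rw [lintegral_mul_const' _ _ enorm_ne_top]
      gcongr
      exact lintegral_stripSet_le hβ0 hβ1 h hpos y
    · rw [indicator_of_notMem hy]
      refine le_of_eq ((setLIntegral_congr_fun hA fun x hx => ?_).trans lintegral_zero)
      exact indicator_of_notMem (fun hxy => hy (hAS x hx y hxy)) _
  · refine AEMeasurable.indicator ?_ hP
    exact (hR.comp measurable_fst).inv.ennreal_ofReal.aemeasurable.mul
      hg.aestronglyMeasurable.enorm.comp_snd

/-- The pointwise bound of the derivative of the maximal function by the variation in the strip. -/
theorem enorm_deriv_rpow_le (hβ0 : 0 < β) (hβ1 : β < 1) (hF : IsACRep F g)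
    (h : IsProfile (fun y => |F y|) K N) (hpos : 0 < ∫ y, |F y|) (x : ℝ) :
    ‖deriv (fracMax β fun y => |F y|) x‖ₑ ^ (1 / (1 - β)) ≤
      ENNReal.ofReal ((2 * (1 - β) / β) ^ (1 / (1 - β)) * (∫ y, |g y|) ^ (1 / (1 - β) - 1)) *
      ∫⁻ y, (stripSet β fun y => |F y|).indicator
        (fun p => ENNReal.ofReal (optRadius β (fun y => |F y|) p.1)⁻¹ * ‖g p.2‖ₑ) (x, y) := by
  set u : ℝ → ℝ := fun y => |F y| with hu
  have hopt := isOptRadius_optRadius hβ0 hβ1 h hpos x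
  have hM := fracMax_pos hβ0 hβ1 h hpos x
  set r := optRadius β u x with hr
  have hr0 : 0 < r := hopt.1
  have h1β : 0 < 1 - β := by linarith
  set q := 1 / (1 - β) with hq
  have hq1 : 1 < q := by rw [hq, lt_div_iff₀ h1β]; linarith
  have hd := hopt.abs_deriv_le hβ0 hβ1 h
  have ha := hopt.ballAvg_le_integral hβ0 hβ1 hF h hM
  have ha0 := ballAvg_nonneg h x hr0
  set E := Ioo (x - r) (x + r) ∩
      {y | |F y| ∈ Icc ((1 - β / 2) * ballAvg u x r) (ballAvg u x r)} with hE
  have hEm : MeasurableSet E := measurableSet_Ioo.inter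
    (measurableSet_Icc.preimage h.continuous.measurable)
  set I := ∫ y in E, |g y| with hI
  have hI0 : 0 ≤ I := setIntegral_nonneg hEm fun y _ => abs_nonneg _
  have hIV : I ≤ ∫ y, |g y| := setIntegral_le_integral hF.integrable_deriv.abs
    (Eventually.of_forall fun y => abs_nonneg _)
  have hlin : ∫⁻ y, (stripSet β u).indicator
      (fun p => ENNReal.ofReal (optRadius β u p.1)⁻¹ * ‖g p.2‖ₑ) (x, y) =
      ENNReal.ofReal (r⁻¹ * I) := by
    rw [ENNReal.ofReal_mul (by positivity), hI,
      ofReal_integral_eq_lintegral_ofReal hF.integrable_deriv.abs.integrableOn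
        (Eventually.of_forall fun y => abs_nonneg _),
      ← lintegral_const_mul' _ _ ENNReal.ofReal_ne_top, ← lintegral_indicator hEm]
    refine lintegral_congr fun y => ?_
    have hiff : (x, y) ∈ stripSet β u ↔ y ∈ E := by
      simp only [stripSet, hE, mem_ofPred_eq, mem_inter_iff, mem_Ioo, mem_Icc, optAvg, abs_lt, hu, hr]
      constructor
      · rintro ⟨⟨h1, h2⟩, h3⟩
        exact ⟨⟨by linarith, by linarith⟩, h3⟩
      · rintro ⟨⟨h1, h2⟩, h3⟩
        exact ⟨⟨by linarith, by linarith⟩, h3⟩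
    by_cases hy : y ∈ E
    · rw [indicator_of_mem hy, indicator_of_mem (hiff.2 hy), ← Real.enorm_abs,
        Real.enorm_of_nonneg (abs_nonneg _)]
    · rw [indicator_of_notMem hy, indicator_of_notMem (fun hc => hy (hiff.1 hc))]
  rw [hlin, ← ENNReal.ofReal_mul (by positivity), ← Real.enorm_abs,
    Real.enorm_of_nonneg (abs_nonneg _), ENNReal.ofReal_rpow_of_nonneg (abs_nonneg _) (by linarith)]
  refine ENNReal.ofReal_le_ofReal ?_
  have hV0 : 0 ≤ ∫ y, |g y| := hI0.trans hIV
  have hbound : |deriv (fracMax β u) x| ≤ (2 * (1 - β) / β) * r ^ (β - 1) * I := by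
    refine hd.trans ?_
    have : ballAvg u x r ≤ 2 / β * I := by
      rw [div_mul_eq_mul_div, le_div_iff₀ hβ0]; linarith
    calc (1 - β) * r ^ (β - 1) * ballAvg u x r ≤ (1 - β) * r ^ (β - 1) * (2 / β * I) := by gcongr
      _ = _ := by ring
  -- This is where the endpoint exponent is forced: `(β - 1) * q = -1`.
  have hrq : (r ^ (β - 1)) ^ q = r⁻¹ := by
    rw [← Real.rpow_mul hr0.le, ← Real.rpow_neg_one]
    congr 1
    rw [hq]; field_simp; ring
  -- All but one of the `q` powers of `I` are spent on the total variation, leaving `I` linear for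
  -- the exchange of integrals.
  have hIq : I ^ q ≤ (∫ y, |g y|) ^ (q - 1) * I := by
    rcases hI0.eq_or_lt with h0 | h0
    · rw [← h0, Real.zero_rpow (by linarith), mul_zero]
    · have : I ^ q = I ^ (q - 1) * I := by rw [Real.rpow_sub_one h0.ne']; field_simp
      rw [this]
      gcongr
  calc |deriv (fracMax β u) x| ^ q ≤ ((2 * (1 - β) / β) * r ^ (β - 1) * I) ^ q :=
        Real.rpow_le_rpow (abs_nonneg _) hbound (by linarith)
    _ = (2 * (1 - β) / β) ^ q * r⁻¹ * I ^ q := by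
        rw [Real.mul_rpow (by positivity) hI0, Real.mul_rpow (by positivity) (by positivity), hrq]
    _ ≤ (2 * (1 - β) / β) ^ q * r⁻¹ * ((∫ y, |g y|) ^ (q - 1) * I) := by gcongr
    _ = _ := by ring

/-- The localized endpoint bound. -/
theorem lintegral_enorm_deriv_rpow_le (hβ0 : 0 < β) (hβ1 : β < 1) (hF : IsACRep F g)
    (h : IsProfile (fun y => |F y|) K N) (hpos : 0 < ∫ y, |F y|) {A S : Set ℝ}
    (hA : MeasurableSet A) (hS : MeasurableSet S)
    (hAS : ∀ x ∈ A, Metric.ball x (optRadius β (fun y => |F y|) x) ⊆ S) :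
    ∫⁻ x in A, ‖deriv (fracMax β fun y => |F y|) x‖ₑ ^ (1 / (1 - β)) ≤
      ENNReal.ofReal ((2 * (1 - β) / β) ^ (1 / (1 - β)) * (∫ y, |g y|) ^ (1 / (1 - β) - 1)) *
      (ENNReal.ofReal (2 * radiusRatio β ^ 2) * ∫⁻ y in S, ‖g y‖ₑ) := by
  refine (lintegral_mono fun x => enorm_deriv_rpow_le hβ0 hβ1 hF h hpos x).trans ?_
  rw [lintegral_const_mul' _ _ ENNReal.ofReal_ne_top]
  gcongr
  refine lintegral_optRadius_inv_le hβ0 hβ1 h hpos hF.integrable_deriv hA hS fun x hx y hy => ?_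
  refine hAS x hx ?_
  rw [Metric.mem_ball, dist_comm, Real.dist_eq]
  exact hy.1

/-- The numerical inequality behind the explicit constant. -/
theorem constant_le (hβ0 : 0 < β) (hβ1 : β < 1) :
    (2 * (1 - β) / β) ^ (1 / (1 - β)) * (2 * radiusRatio β ^ 2) ≤
      ((2 : ℝ) ^ (-3 * β - 2 + 4 / β) * (3 : ℝ) ^ (2 * (1 - β) ^ 2 / β)) ^ (1 / (1 - β)) := by
  have h1β : 0 < 1 - β := by linarith
  -- In terms of `s`, `radiusRatio β ^ 2 = 4 * 36 ^ s` and `1 / (1 - β) = 1 + 1 / s`. After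
  -- cancelling `(1 / 2) ^ (1 / (1 - β))`, the claim becomes `(4 * s) ^ (1 + 1 / s) ≤ 16 * 4 ^ s`,
  -- which follows from `(4 * s) ^ (1 / s) ≤ exp 2 ≤ 7.4` and `2 * s ≤ 4 ^ s`.
  set s := (1 - β) / β with hs
  have hs0 : 0 < s := by positivity
  have hβs : β⁻¹ = 1 + s := by rw [hs]; field_simp; ring
  have hq : 1 / (1 - β) = 1 + 1 / s := by rw [hs]; field_simp; ring
  have hρ : radiusRatio β ^ 2 = 4 * (36 : ℝ) ^ s := by
    have e1 : radiusRatio β = 2 * (6 : ℝ) ^ s := by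
      rw [radiusRatio, Real.mul_rpow (by norm_num) (by positivity), ← Real.rpow_mul (by norm_num),
        show (1 - β) * β⁻¹ = s by rw [hs]; field_simp, hβs, Real.rpow_add (by norm_num),
        Real.rpow_one, mul_assoc, ← Real.mul_rpow (by norm_num) (by norm_num)]
      norm_num
    rw [e1, mul_pow, ← Real.rpow_natCast ((6 : ℝ) ^ s), ← Real.rpow_mul (by norm_num), mul_comm s,
      Real.rpow_mul (by norm_num)]
    norm_num
  have hC : ((2 : ℝ) ^ (-3 * β - 2 + 4 / β) * (3 : ℝ) ^ (2 * (1 - β) ^ 2 / β)) ^ (1 / (1 - β)) =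
      (1 / 2) ^ (1 / (1 - β)) * (128 * 144 ^ s) := by
    rw [Real.mul_rpow (by positivity) (by positivity), ← Real.rpow_mul (by norm_num),
      ← Real.rpow_mul (by norm_num),
      show (-3 * β - 2 + 4 / β) * (1 / (1 - β)) = -(1 / (1 - β)) + 7 + 4 * s by
        rw [hs]; field_simp; ring,
      show 2 * (1 - β) ^ 2 / β * (1 / (1 - β)) = 2 * s by rw [hs]; field_simp,
      Real.rpow_add (by norm_num), Real.rpow_add (by norm_num), Real.rpow_neg (by norm_num),
      one_div 2, Real.inv_rpow (by norm_num), Real.rpow_mul (by norm_num),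
      Real.rpow_mul (by norm_num), mul_assoc, mul_assoc,
      ← Real.mul_rpow (by norm_num) (by norm_num)]
    norm_num
  rw [hC, hρ]
  have hsplit : (2 * (1 - β) / β) ^ (1 / (1 - β)) =
      (1 / 2 : ℝ) ^ (1 / (1 - β)) * (4 * s) ^ (1 / (1 - β)) := by
    rw [← Real.mul_rpow (by norm_num) (by positivity)]
    congr 1
    rw [hs]; ring
  rw [hsplit, mul_assoc]
  refine mul_le_mul_of_nonneg_left ?_ (by positivity)
  have hlog : (4 * s) ^ (1 / s) ≤ Real.exp 2 := by
    rw [Real.rpow_def_of_pos (by positivity), Real.exp_le_exp]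
    have h1 : Real.log (4 * s) = Real.log 2 + Real.log (2 * s) := by
      rw [← Real.log_mul (by norm_num) (by positivity)]; congr 1; ring
    have h2 := Real.log_le_sub_one_of_pos (show 0 < 2 * s by positivity)
    have h3 := Real.log_two_lt_d9
    rw [mul_one_div, div_le_iff₀ hs0]
    linarith
  have he2 : Real.exp 2 ≤ 7.4 := by
    have := Real.exp_one_lt_d9
    rw [show (2 : ℝ) = 1 + 1 by norm_num, Real.exp_add]
    nlinarith [Real.exp_pos 1]
  have h4s : 2 * s ≤ (4 : ℝ) ^ s := by
    have h1 : (4 : ℝ) ^ s = Real.exp (2 * s * Real.log 2) := by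
      rw [Real.rpow_def_of_pos (by norm_num), show (4 : ℝ) = 2 ^ 2 by norm_num, Real.log_pow]
      congr 1; push_cast; ring
    have h2 := Real.add_one_le_exp (2 * s * Real.log 2 - 1)
    rw [Real.exp_sub, le_div_iff₀ (Real.exp_pos 1), ← h1] at h2
    have h3 := Real.exp_one_gt_d9
    have h4 := Real.log_two_gt_d9
    have h5 : 2 * s * Real.log 2 * Real.exp 1 ≥ 2 * s * 0.6931471803 * 2.7182818283 := by gcongr
    nlinarith
  have h144 : (144 : ℝ) ^ s = 36 ^ s * 4 ^ s := by
    rw [← Real.mul_rpow (by norm_num) (by norm_num)]; norm_num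
  rw [hq, Real.rpow_add (by positivity), Real.rpow_one, h144]
  have h36 : (0 : ℝ) < 36 ^ s := by positivity
  calc 4 * s * (4 * s) ^ (1 / s) * (2 * (4 * 36 ^ s))
      ≤ 4 * s * 7.4 * (2 * (4 * 36 ^ s)) := by
        gcongr
        exact hlog.trans he2
    _ ≤ 128 * (36 ^ s * 4 ^ s) := by nlinarith

end StripBound

/-! ### The global endpoint bound with the explicit constant. -/

section Bound

variable {β : ℝ} {F g : ℝ → ℝ} {K N : ℝ}

theorem IsACRep.isProfile (hF : IsACRep F g) (hK : (∫ y, |F y|) + ∫ y, |g y| ≤ K)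
    (hN : ∫ y, |F y| ≤ N) : IsProfile (fun y => |F y|) K N where
  continuous := hF.continuous.abs
  nonneg _ := abs_nonneg _
  integrable := hF.integrable.abs
  le y := (hF.abs_le y).trans hK
  integral_le := hN

theorem fracMax_eq_zero {u : ℝ → ℝ} (h : IsProfile u K N) (h0 : ¬ 0 < ∫ y, u y) :
    fracMax β u = fun _ => 0 := by
  funext x
  have h' : IsProfile u K 0 := { h with integral_le := not_lt.1 h0 }
  refine le_antisymm (fracMax_le h fun r hr => ?_) (fracMax_nonneg x)
  simpa using fracAvg_le_N (β := β) h' x hr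

theorem lintegral_enorm_eq {g : ℝ → ℝ} (hg : Integrable g) :
    ∫⁻ y, ‖g y‖ₑ = ENNReal.ofReal (∫ y, |g y|) :=
  (ofReal_integral_norm_eq_lintegral_enorm hg).symm

theorem IsACRep.eLpNorm_deriv_fracMax_le (hβ0 : 0 < β) (hβ1 : β < 1) (hF : IsACRep F g) :
    eLpNorm (deriv (fracMax β fun y => |F y|)) (ENNReal.ofReal (1 / (1 - β))) volume ≤
      ENNReal.ofReal ((2 : ℝ) ^ (-3 * β - 2 + 4 / β) * (3 : ℝ) ^ (2 * (1 - β) ^ 2 / β)) *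
        eLpNorm g 1 volume := by
  have h := hF.isProfile le_rfl le_rfl
  by_cases hpos : 0 < ∫ y, |F y|
  swap
  · rw [fracMax_eq_zero h hpos]
    simp
  have h1β : 0 < 1 - β := by linarith
  have hC := constant_le hβ0 hβ1
  have hlin := lintegral_enorm_deriv_rpow_le hβ0 hβ1 hF h hpos MeasurableSet.univ
    MeasurableSet.univ (fun _ _ => subset_univ _)
  set C := (2 : ℝ) ^ (-3 * β - 2 + 4 / β) * (3 : ℝ) ^ (2 * (1 - β) ^ 2 / β)
  set q := 1 / (1 - β) with hq
  have hq0 : 0 < q := by positivity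
  have hC0 : 0 ≤ C := by positivity
  set V := ∫ y, |g y| with hV
  have hV0 : 0 ≤ V := integral_nonneg fun y => abs_nonneg _
  simp only [Measure.restrict_univ] at hlin
  rw [eLpNorm_one_eq_lintegral_enorm, eLpNorm_eq_lintegral_rpow_enorm_toReal (by simpa using hq0)
    ENNReal.ofReal_ne_top, ENNReal.toReal_ofReal hq0.le, one_div q,
    ENNReal.rpow_inv_le_iff hq0]
  refine hlin.trans ?_
  rw [lintegral_enorm_eq hF.integrable_deriv, ← hV, ← ENNReal.ofReal_mul hC0,
    ENNReal.ofReal_rpow_of_nonneg (by positivity) hq0.le, ← ENNReal.ofReal_mul (by positivity),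
    ← ENNReal.ofReal_mul (by positivity)]
  refine ENNReal.ofReal_le_ofReal ?_
  rw [Real.mul_rpow hC0 hV0]
  have hVq : V ^ (q - 1) * V = V ^ q := by
    rcases hV0.eq_or_lt with h0 | h0
    · rw [← h0, mul_zero, Real.zero_rpow hq0.ne']
    · rw [Real.rpow_sub_one h0.ne']; field_simp
  calc _ = (2 * (1 - β) / β) ^ q * (2 * radiusRatio β ^ 2) * (V ^ (q - 1) * V) := by ring
    _ ≤ C ^ q * V ^ q := by
      rw [hVq]
      gcongr

end Bound

/-! ### Smallness of the derivative near infinity. -/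

section Tail

variable {β : ℝ} {F g : ℝ → ℝ} {K N V : ℝ}

/-- The constant in the localized endpoint bound, for `‖f'‖₁ ≤ V`. -/
noncomputable def stripConst (β V : ℝ) : ℝ≥0∞ :=
  ENNReal.ofReal ((2 * (1 - β) / β) ^ (1 / (1 - β)) * V ^ (1 / (1 - β) - 1)) *
    ENNReal.ofReal (2 * radiusRatio β ^ 2)

/-- Points are split by whether the optimal radius reaches `|x| / 2`. If it does, `|deriv| ≤ N * r ^
(β - 2)` gives integrable decay in `x`. If not, the optimal ball lies in `{R / 2 < |y|}` and the
localized bound sees only the tail of `g`. -/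
theorem lintegral_tail_le (hβ0 : 0 < β) (hβ1 : β < 1) (hF : IsACRep F g)
    (h : IsProfile (fun y => |F y|) K N) (hpos : 0 < ∫ y, |F y|) (hV : ∫ y, |g y| ≤ V) {R : ℝ}
    (hR : 1 ≤ R) :
    ∫⁻ x in {x : ℝ | R < |x|}, ‖deriv (fracMax β fun y => |F y|) x‖ₑ ^ (1 / (1 - β)) ≤
      ENNReal.ofReal (N ^ (1 / (1 - β)) * 4 ^ (1 + 1 / (1 - β))) *
        (∫⁻ x in {x : ℝ | R < |x|}, ENNReal.ofReal ((1 + ‖x‖) ^ (-(1 + 1 / (1 - β))))) +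
      stripConst β V * ∫⁻ y in {y : ℝ | R / 2 < |y|}, ‖g y‖ₑ := by
  set u : ℝ → ℝ := fun y => |F y|
  have hTm : ∀ R : ℝ, MeasurableSet {x : ℝ | R < |x|} := fun R =>
    measurableSet_lt measurable_const measurable_id.abs
  have hBm : MeasurableSet {x : ℝ | |x| / 2 ≤ optRadius β u x} :=
    measurableSet_le (measurable_id.abs.div_const 2) (measurable_optRadius hβ0 hβ1 h hpos)
  have h1β : 0 < 1 - β := by linarith
  set q := 1 / (1 - β) with hq
  have hq1 : 1 < q := by rw [hq, lt_div_iff₀ h1β]; linarith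
  rw [← lintegral_inter_add_sdiff _ {x : ℝ | R < |x|} hBm]
  refine add_le_add ?_ ?_
  · rw [← lintegral_const_mul' _ _ ENNReal.ofReal_ne_top]
    refine le_trans ?_ (lintegral_mono_set
      (inter_subset_left (t := {x : ℝ | |x| / 2 ≤ optRadius β u x})))
    refine setLIntegral_mono' ((hTm R).inter hBm) fun x hx => ?_
    obtain ⟨hxR, hxB⟩ := hx
    simp only [mem_ofPred_eq] at hxR hxB
    have hopt := isOptRadius_optRadius hβ0 hβ1 h hpos x
    set r := optRadius β u x
    have hr0 : 0 < r := hopt.1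
    have hN := h.N_nonneg
    have hd : |deriv (fracMax β u) x| ≤ N * r ^ (β - 2) := by
      refine (hopt.abs_deriv_le hβ0 hβ1 h).trans ?_
      have h1 := ballAvg_le_N h x hr0
      have h2 : r ^ (β - 2) = r ^ (β - 1) / r := by
        rw [← Real.rpow_sub_one hr0.ne']; congr 1; ring
      have h3 : 0 ≤ N * (r ^ (β - 1) / r) := by positivity
      rw [h2]
      calc (1 - β) * r ^ (β - 1) * ballAvg u x r ≤ (1 - β) * r ^ (β - 1) * (N / (2 * r)) := by
            gcongr
        _ = (1 - β) / 2 * (N * (r ^ (β - 1) / r)) := by field_simp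
        _ ≤ 1 * (N * (r ^ (β - 1) / r)) := by gcongr; linarith
        _ = _ := one_mul _
    rw [← ENNReal.ofReal_mul (by positivity), ← Real.enorm_abs,
      Real.enorm_of_nonneg (abs_nonneg _), ENNReal.ofReal_rpow_of_nonneg (abs_nonneg _)
      (by linarith)]
    refine ENNReal.ofReal_le_ofReal ?_
    have he : (β - 2) * q = -(1 + q) := by rw [hq]; field_simp; ring
    -- Since `|x| > R ≥ 1`, one has `(1 + |x|) / 4 ≤ |x| / 2 ≤ r`.
    have hx4 : (1 + ‖x‖) / 4 ≤ r := by
      rw [Real.norm_eq_abs]; linarith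
    calc |deriv (fracMax β u) x| ^ q ≤ (N * r ^ (β - 2)) ^ q :=
          Real.rpow_le_rpow (abs_nonneg _) hd (by linarith)
      _ = N ^ q * r ^ (-(1 + q)) := by
          rw [Real.mul_rpow hN (by positivity), ← Real.rpow_mul hr0.le, he]
      _ ≤ N ^ q * ((1 + ‖x‖) / 4) ^ (-(1 + q)) := by
          refine mul_le_mul_of_nonneg_left ?_ (by positivity)
          exact Real.rpow_le_rpow_of_nonpos (by positivity) hx4 (by linarith)
      _ = _ := by
          rw [Real.div_rpow (by positivity) (by norm_num), Real.rpow_neg (x := 4) (by norm_num),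
            div_inv_eq_mul]
          ring
  · refine (lintegral_enorm_deriv_rpow_le hβ0 hβ1 hF h hpos ((hTm R).diff hBm) (hTm (R / 2))
      fun x hx y hy => ?_).trans ?_
    · obtain ⟨hxR, hxB⟩ := hx
      simp only [mem_ofPred_eq, not_le] at hxR hxB
      rw [Metric.mem_ball, dist_comm, Real.dist_eq] at hy
      have := abs_sub_abs_le_abs_sub x y
      change R / 2 < |y|
      linarith
    · rw [← mul_assoc, stripConst]
      have : 0 ≤ ∫ y, |g y| := integral_nonneg fun y => abs_nonneg _
      have : 0 < 2 * (1 - β) / β := by positivity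
      gcongr

theorem tendsto_lintegral_tail {f : ℝ → ℝ≥0∞} (hf' : AEMeasurable f) (hfi' : ∫⁻ x, f x ≠ ⊤) :
    Tendsto (fun R : ℝ => ∫⁻ x in {x : ℝ | R < |x|}, f x) atTop (𝓝 0) := by
  have hTm : ∀ R : ℝ, MeasurableSet {x : ℝ | R < |x|} := fun R =>
    measurableSet_lt measurable_const measurable_id.abs
  simp_rw [fun R : ℝ => lintegral_congr_ae (ae_restrict_of_ae
    (s := {x : ℝ | R < |x|}) hf'.ae_eq_mk)]
  have hfi : ∫⁻ x, hf'.mk f x ≠ ⊤ := by rwa [← lintegral_congr_ae hf'.ae_eq_mk]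
  have hf := hf'.measurable_mk
  have := tendsto_lintegral_filter_of_dominated_convergence (μ := volume) (l := atTop)
    (F := fun R : ℝ => {x : ℝ | R < |x|}.indicator (hf'.mk f)) (f := fun _ => 0) (hf'.mk f)
    (Eventually.of_forall fun R => hf.indicator (hTm R))
    (Eventually.of_forall fun R => Eventually.of_forall fun x => indicator_le_self _ _ _) hfi
    (Eventually.of_forall fun x => by
      refine tendsto_const_nhds.congr' ?_
      filter_upwards [eventually_ge_atTop |x|] with R hR
      rw [indicator_of_notMem (show x ∉ {x : ℝ | R < |x|} from not_lt.2 hR)])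
  simpa [lintegral_indicator (hTm _)] using this

end Tail

/-! ### Convergence of the derivatives along sequences. -/

section Convergence

variable {β : ℝ} {F g : ℝ → ℝ} {G γ : ℕ → ℝ → ℝ} {K N V : ℝ} {d : ℕ → ℝ}

/-- The difference is dominated by the average of `|G₁ - F|`, itself a profile with both bounds
equal to `η`. The estimate is uniform in centre and radius. -/
theorem abs_fracAvg_sub_le (hβ0 : 0 < β) (hβ1 : β < 1) {G₁ g₁ : ℝ → ℝ} (hF : IsACRep F g)
    (hG : IsACRep G₁ g₁) {η : ℝ} (hη : (∫ y, |G₁ y - F y|) + ∫ y, |g₁ y - g y| ≤ η) (x : ℝ)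
    {r : ℝ} (hr : 0 < r) :
    |fracAvg β (fun y => |G₁ y|) x r - fracAvg β (fun y => |F y|) x r| ≤ 2 * η := by
  have hD := (hG.sub hF).isProfile (K := η) (N := η) hη (le_trans (le_add_of_nonneg_right
    (integral_nonneg fun y => abs_nonneg _)) hη)
  refine le_trans ?_ ((fracAvg_le hβ0 hβ1 hD x hr).trans (two_mul η).ge)
  have hp : 0 ≤ r ^ (β - 1) / 2 := by positivity
  unfold fracAvg
  rw [← mul_sub, abs_mul, abs_of_nonneg hp,
    ← intervalIntegral.integral_sub hG.integrable.abs.intervalIntegrable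
      hF.integrable.abs.intervalIntegrable]
  refine mul_le_mul_of_nonneg_left ?_ hp
  refine (intervalIntegral.abs_integral_le_integral_abs (by linarith)).trans ?_
  refine intervalIntegral.integral_mono_on (by linarith)
    (hG.integrable.abs.sub hF.integrable.abs).abs.intervalIntegrable
    (hG.integrable.sub hF.integrable).abs.intervalIntegrable fun y _ => ?_
  exact abs_abs_sub_abs_le_abs_sub _ _

theorem abs_fracMax_sub_le (hβ0 : 0 < β) (hβ1 : β < 1) {G₁ g₁ : ℝ → ℝ} (hF : IsACRep F g)
    (hG : IsACRep G₁ g₁) {η : ℝ} (hη : (∫ y, |G₁ y - F y|) + ∫ y, |g₁ y - g y| ≤ η) (x : ℝ) :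
    |fracMax β (fun y => |G₁ y|) x - fracMax β (fun y => |F y|) x| ≤ 2 * η := by
  have hF' := hF.isProfile le_rfl le_rfl
  have hG' := hG.isProfile le_rfl le_rfl
  rw [abs_le]
  constructor
  · have : fracMax β (fun y => |F y|) x ≤ fracMax β (fun y => |G₁ y|) x + 2 * η :=
      fracMax_le hF' fun r hr => by
        have h1 := abs_le.1 (abs_fracAvg_sub_le hβ0 hβ1 hF hG hη x hr)
        have h2 := fracAvg_le_fracMax hβ0 hβ1 hG' x hr
        linarith [h1.1]
    linarith
  · have : fracMax β (fun y => |G₁ y|) x ≤ fracMax β (fun y => |F y|) x + 2 * η :=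
      fracMax_le hG' fun r hr => by
        have h1 := abs_le.1 (abs_fracAvg_sub_le hβ0 hβ1 hF hG hη x hr)
        have h2 := fracAvg_le_fracMax hβ0 hβ1 hF' x hr
        linarith [h1.2]
    linarith

/-- Almost everywhere convergence of the derivatives of the maximal functions. -/
theorem ae_tendsto_deriv_fracMax (hβ0 : 0 < β) (hβ1 : β < 1) (hF : IsACRep F g)
    (hG : ∀ n, IsACRep (G n) (γ n)) (hFp : IsProfile (fun y => |F y|) K N)
    (hGp : ∀ n, IsProfile (fun y => |G n y|) K N) (hFpos : 0 < ∫ y, |F y|)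
    (hGpos : ∀ n, 0 < ∫ y, |G n y|)
    (hd : ∀ n, (∫ y, |G n y - F y|) + ∫ y, |γ n y - g y| ≤ d n) (hd0 : Tendsto d atTop (𝓝 0)) :
    ∀ᵐ x, Tendsto (fun n => deriv (fracMax β fun y => |G n y|) x) atTop
      (𝓝 (deriv (fracMax β fun y => |F y|) x)) := by
  filter_upwards [ae_differentiableAt_fracMax hβ0 hβ1 hFp hFpos,
    ae_all_iff.2 fun n => ae_differentiableAt_fracMax hβ0 hβ1 (hGp n) (hGpos n)] with x hxF hxG
  have hd2 : Tendsto (fun n => 2 * d n) atTop (𝓝 0) := by simpa using hd0.const_mul 2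
  have hunif : ∀ n y, |(|G n y| - |F y|)| ≤ d n := fun n y =>
    (abs_abs_sub_abs_le_abs_sub _ _).trans ((((hG n).sub hF).abs_le y).trans (hd n))
  -- Optimal radii need not be unique, so they converge only along subsequences. This suffices
  -- because every limiting optimal radius gives the same derivative at `x`.
  refine tendsto_of_subseq_tendsto fun ns hns => ?_
  have hM : Tendsto (fun n => fracMax β (fun y => |G (ns n) y|) x) atTop
      (𝓝 (fracMax β (fun y => |F y|) x)) := by
    rw [tendsto_iff_dist_tendsto_zero]
    exact squeeze_zero (fun _ => dist_nonneg)
      (fun n => abs_fracMax_sub_le hβ0 hβ1 hF (hG _) (hd _) x) (hd2.comp hns)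
  obtain ⟨r, hr, φ, hφ, hlim⟩ := exists_subseq_isOptRadius (v := fun n y => |G (ns n) y|)
    (ξ := fun _ => x) (ρ := fun n => optRadius β (fun y => |G (ns n) y|) x)
    hβ0 hβ1 (fun n => hGp _) hFp tendsto_const_nhds (hd2.comp hns)
    (fun n y r hr => abs_fracAvg_sub_le hβ0 hβ1 hF (hG _) (hd _) y hr) hM
    (fracMax_pos hβ0 hβ1 hFp hFpos x)
    (fun n => isOptRadius_optRadius hβ0 hβ1 (hGp _) (hGpos _) x)
  refine ⟨φ, ?_⟩
  have heq : ∀ n, deriv (fracMax β fun y => |G (ns (φ n)) y|) x =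
      (optRadius β (fun y => |G (ns (φ n)) y|) x) ^ (β - 1) / 2 *
        (|G (ns (φ n)) (x + optRadius β (fun y => |G (ns (φ n)) y|) x)| -
          |G (ns (φ n)) (x - optRadius β (fun y => |G (ns (φ n)) y|) x)|) := fun n =>
    (isOptRadius_optRadius hβ0 hβ1 (hGp _) (hGpos _) x).deriv_eq hβ0 hβ1 (hGp _) (hxG _)
  simp only [heq]
  rw [hr.deriv_eq hβ0 hβ1 hFp hxF]
  have hdφ : Tendsto (fun n => d (ns (φ n))) atTop (𝓝 0) :=
    hd0.comp (hns.comp hφ.tendsto_atTop)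
  have hval : ∀ z : ℕ → ℝ, ∀ z₀, Tendsto z atTop (𝓝 z₀) →
      Tendsto (fun n => |G (ns (φ n)) (z n)|) atTop (𝓝 |F z₀|) := by
    intro z z₀ hz
    have h1 : Tendsto (fun n => |F (z n)|) atTop (𝓝 |F z₀|) :=
      (hF.continuous.abs.tendsto z₀).comp hz
    have h2 : Tendsto (fun n => |G (ns (φ n)) (z n)| - |F (z n)|) atTop (𝓝 0) :=
      squeeze_zero_norm (fun n => hunif _ _) hdφ
    simpa using h2.add h1
  refine Tendsto.mul ((Tendsto.rpow_const hlim (Or.inl hr.1.ne')).div_const 2) ?_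
  exact (hval _ _ (tendsto_const_nhds.add hlim)).sub (hval _ _ (tendsto_const_nhds.sub hlim))

/-- A uniform bound of the derivative where the maximal function is bounded below. -/
theorem abs_deriv_fracMax_le {u : ℝ → ℝ} (hβ0 : 0 < β) (hβ1 : β < 1) (h : IsProfile u K N)
    (hpos : 0 < ∫ y, u y) {c a b x : ℝ} (ha : 0 < a)
    (hab : ∀ (u : ℝ → ℝ) (x r : ℝ), IsProfile u K N → 0 < r → c ≤ fracAvg β u x r → r ∈ Icc a b)
    (hx : c ≤ fracMax β u x) : |deriv (fracMax β u) x| ≤ a ^ (β - 1) * K := by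
  have hopt := isOptRadius_optRadius hβ0 hβ1 h hpos x
  have hr := hab u x _ h hopt.1 (hopt.2 ▸ hx)
  have hK := h.K_nonneg
  have h1 := ballAvg_le_K h x hopt.1
  have h0 := ballAvg_nonneg h x hopt.1
  have hr0 := hopt.1
  have hp : 0 ≤ optRadius β u x ^ (β - 1) := by positivity
  have h2 : optRadius β u x ^ (β - 1) ≤ a ^ (β - 1) :=
    Real.rpow_le_rpow_of_nonpos ha hr.1 (by linarith)
  calc _ ≤ (1 - β) * optRadius β u x ^ (β - 1) * ballAvg u x (optRadius β u x) :=
        hopt.abs_deriv_le hβ0 hβ1 h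
    _ ≤ 1 * optRadius β u x ^ (β - 1) * K := by gcongr; linarith
    _ ≤ a ^ (β - 1) * K := by rw [one_mul]; gcongr

/-- The derivatives of the maximal functions themselves converge here; outer absolute values are
inserted only afterwards. -/
theorem tendsto_lintegral_deriv_fracMax_sub (hβ0 : 0 < β) (hβ1 : β < 1) (hF : IsACRep F g)
    (hG : ∀ n, IsACRep (G n) (γ n)) (hFp : IsProfile (fun y => |F y|) K N)
    (hGp : ∀ n, IsProfile (fun y => |G n y|) K N) (hFpos : 0 < ∫ y, |F y|)
    (hGpos : ∀ n, 0 < ∫ y, |G n y|) (hgV : ∫ y, |g y| ≤ V) (hγV : ∀ n, ∫ y, |γ n y| ≤ V)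
    (hd : ∀ n, (∫ y, |G n y - F y|) + ∫ y, |γ n y - g y| ≤ d n) (hd0 : Tendsto d atTop (𝓝 0)) :
    Tendsto (fun n => ∫⁻ x, ‖deriv (fracMax β fun y => |G n y|) x -
      deriv (fracMax β fun y => |F y|) x‖ₑ ^ (1 / (1 - β))) atTop (𝓝 0) := by
  have h1β : 0 < 1 - β := by linarith
  have hTm : ∀ R : ℝ, MeasurableSet {x : ℝ | R < |x|} := fun R =>
    measurableSet_lt measurable_const measurable_id.abs
  set D := fun n => deriv (fracMax β fun y => |G n y|) with hD
  set D₀ := deriv (fracMax β fun y => |F y|) with hD₀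
  have hDm : ∀ n, Measurable (D n) := fun n => measurable_deriv _
  have hD₀m : Measurable D₀ := measurable_deriv _
  have htail := fun R hR => lintegral_tail_le hβ0 hβ1 hF hFp hFpos hgV (R := R) hR
  have htailn := fun n R hR => lintegral_tail_le hβ0 hβ1 (hG n) (hGp n) (hGpos n) (hγV n)
    (R := R) hR
  have hae := ae_tendsto_deriv_fracMax hβ0 hβ1 hF hG hFp hGp hFpos hGpos hd hd0
  set q := 1 / (1 - β) with hq
  have hq1 : 1 < q := by rw [hq, lt_div_iff₀ h1β]; linarith
  -- convergence on compact intervals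
  have hloc : ∀ R : ℝ, 0 ≤ R → Tendsto
      (fun n => ∫⁻ x in {x : ℝ | R < |x|}ᶜ, ‖D n x - D₀ x‖ₑ ^ q) atTop (𝓝 0) := by
    intro R hR
    obtain ⟨c, hc, hcx⟩ := exists_lower_bound hβ0 hβ1 hFp hFpos hR
    obtain ⟨a, b, ha, hab⟩ :=
      exists_radius_bounds hβ0 hβ1 hFp.K_nonneg hFp.N_nonneg (half_pos hc)
    set B := a ^ (β - 1) * K
    have hfin : volume ({x : ℝ | R < |x|}ᶜ) ≠ ⊤ := by
      have : {x : ℝ | R < |x|}ᶜ = Icc (-R) R := by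
        ext x
        simp [abs_le]
      rw [this]
      simp
    have := tendsto_lintegral_filter_of_dominated_convergence
      (μ := volume.restrict {x : ℝ | R < |x|}ᶜ) (l := atTop)
      (F := fun n x => ‖D n x - D₀ x‖ₑ ^ q) (f := fun _ => 0)
      (fun _ => ENNReal.ofReal (2 * B) ^ q)
      (Eventually.of_forall fun n =>
        ((hDm n).sub hD₀m).enorm.pow_const q)
      (by
        -- The maximal functions differ by at most `2 * d n < c / 2`, so that of `G n` stays above
        -- `c / 2`, the level for which `a` and `b` were chosen.
        filter_upwards [hd0.eventually (gt_mem_nhds (show 0 < c / 4 by positivity))] with n hn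
        refine (ae_restrict_iff' (hTm R).compl).2 (Eventually.of_forall fun x hx => ?_)
        have hxR : |x| ≤ R := not_lt.1 hx
        have h0 := hcx x hxR
        have h1 := abs_fracMax_sub_le hβ0 hβ1 hF (hG n) (hd n) x
        have h2 := abs_deriv_fracMax_le hβ0 hβ1 hFp hFpos ha hab (x := x) (by linarith)
        have h3 := abs_deriv_fracMax_le hβ0 hβ1 (hGp n) (hGpos n) ha hab (x := x)
          (by linarith [(abs_le.1 h1).1])
        refine ENNReal.rpow_le_rpow ?_ (by linarith)
        rw [← Real.enorm_abs, Real.enorm_of_nonneg (abs_nonneg _)]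
        refine ENNReal.ofReal_le_ofReal ((abs_sub _ _).trans ?_)
        change |D n x| + |D₀ x| ≤ 2 * B
        linarith)
      (by
        rw [lintegral_const, Measure.restrict_apply_univ]
        exact ENNReal.mul_ne_top (ENNReal.rpow_ne_top_of_nonneg (by linarith)
          ENNReal.ofReal_ne_top) hfin)
      (ae_restrict_of_ae (by
        filter_upwards [hae] with x hx
        have h1 : Tendsto (fun n => D n x - D₀ x) atTop (𝓝 0) := by
          rw [← sub_self (D₀ x)]
          exact hx.sub_const (D₀ x)
        have h2 := (ENNReal.continuous_rpow_const (y := q)).tendsto _ |>.comp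
          ((continuous_enorm (E := ℝ)).tendsto _ |>.comp h1)
        simpa [Function.comp_def, ENNReal.zero_rpow_of_pos (show 0 < q by linarith)] using h2))
    simpa using this
  -- the tails
  set c₁ := ENNReal.ofReal (N ^ q * 4 ^ (1 + q))
  set J : ℝ → ℝ≥0∞ := fun x => ENNReal.ofReal ((1 + ‖x‖) ^ (-(1 + q))) with hJ
  have hJi : Tendsto (fun R : ℝ => ∫⁻ x in {x : ℝ | R < |x|}, J x) atTop (𝓝 0) := by
    have hint : Integrable (fun x : ℝ => (1 + ‖x‖) ^ (-(1 + q))) :=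
      integrable_one_add_norm (by simp; linarith)
    refine tendsto_lintegral_tail hint.aestronglyMeasurable.aemeasurable.ennreal_ofReal ?_
    exact hint.lintegral_lt_top.ne
  have hgi : Tendsto (fun R : ℝ => ∫⁻ x in {x : ℝ | R / 2 < |x|}, ‖g x‖ₑ) atTop (𝓝 0) :=
    (tendsto_lintegral_tail hF.integrable_deriv.aestronglyMeasurable.enorm
      hF.integrable_deriv.2.ne).comp (tendsto_id.atTop_div_const two_pos)
  set τ : ℝ → ℝ≥0∞ := fun R => c₁ * (∫⁻ x in {x : ℝ | R < |x|}, J x) +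
    stripConst β V * ∫⁻ y in {y : ℝ | R / 2 < |y|}, ‖g y‖ₑ with hτ
  have hSC : stripConst β V ≠ ⊤ := ENNReal.mul_ne_top ENNReal.ofReal_ne_top ENNReal.ofReal_ne_top
  have hτ0 : Tendsto (fun R => 2 ^ (q - 1) * (2 * τ R)) atTop (𝓝 0) := by
    have h1 : Tendsto τ atTop (𝓝 0) := by
      simpa using (ENNReal.Tendsto.const_mul hJi (Or.inr ENNReal.ofReal_ne_top)).add
        (ENNReal.Tendsto.const_mul hgi (Or.inr hSC))
    simpa using ENNReal.Tendsto.const_mul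
      (ENNReal.Tendsto.const_mul h1 (Or.inr (ENNReal.ofNat_ne_top (n := 2))))
      (Or.inr (ENNReal.rpow_ne_top_of_nonneg (by linarith) (ENNReal.ofNat_ne_top (n := 2))))
  have hbound : ∀ R : ℝ, 1 ≤ R → ∀ n, ∫⁻ x, ‖D n x - D₀ x‖ₑ ^ q ≤
      (∫⁻ x in {x : ℝ | R < |x|}ᶜ, ‖D n x - D₀ x‖ₑ ^ q) +
        2 ^ (q - 1) * (2 * τ R + stripConst β V * ENNReal.ofReal (d n)) := by
    intro R hR n
    rw [← lintegral_add_compl _ (hTm R), add_comm]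
    refine add_le_add le_rfl ?_
    -- The tails of the varying `γ n` are charged to that of the fixed `g`, up to `d n`; thus `R`
    -- can be chosen before `n`.
    have hγ : ∫⁻ y in {y : ℝ | R / 2 < |y|}, ‖γ n y‖ₑ ≤
        (∫⁻ y in {y : ℝ | R / 2 < |y|}, ‖g y‖ₑ) + ENNReal.ofReal (d n) := by
      calc _ ≤ ∫⁻ y in {y : ℝ | R / 2 < |y|}, (‖g y‖ₑ + ‖γ n y - g y‖ₑ) := by
            refine lintegral_mono fun y => ?_
            calc ‖γ n y‖ₑ = ‖g y + (γ n y - g y)‖ₑ := by congr 1; ring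
              _ ≤ _ := enorm_add_le _ _
        _ = (∫⁻ y in {y : ℝ | R / 2 < |y|}, ‖g y‖ₑ) +
            ∫⁻ y in {y : ℝ | R / 2 < |y|}, ‖γ n y - g y‖ₑ :=
            lintegral_add_left' hF.integrable_deriv.aestronglyMeasurable.enorm.restrict _
        _ ≤ _ := by
            refine add_le_add le_rfl ((setLIntegral_le_lintegral _ _).trans ?_)
            refine (lintegral_enorm_eq
              ((hG n).integrable_deriv.sub hF.integrable_deriv)).trans_le ?_
            refine ENNReal.ofReal_le_ofReal (le_trans ?_ (hd n))
            exact le_add_of_nonneg_left (integral_nonneg fun y => abs_nonneg _)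
    calc ∫⁻ x in {x : ℝ | R < |x|}, ‖D n x - D₀ x‖ₑ ^ q
        ≤ ∫⁻ x in {x : ℝ | R < |x|}, 2 ^ (q - 1) * (‖D n x‖ₑ ^ q + ‖D₀ x‖ₑ ^ q) := by
          refine lintegral_mono fun x => ?_
          refine le_trans (ENNReal.rpow_le_rpow enorm_sub_le (by linarith)) ?_
          exact ENNReal.rpow_add_le_mul_rpow_add_rpow _ _ hq1.le
      _ = 2 ^ (q - 1) * ((∫⁻ x in {x : ℝ | R < |x|}, ‖D n x‖ₑ ^ q) +
          ∫⁻ x in {x : ℝ | R < |x|}, ‖D₀ x‖ₑ ^ q) := by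
          rw [lintegral_const_mul' _ _ (ENNReal.rpow_ne_top_of_nonneg (by linarith)
              (ENNReal.ofNat_ne_top (n := 2))), lintegral_add_left ((hDm n).enorm.pow_const q)]
      _ ≤ 2 ^ (q - 1) * ((c₁ * (∫⁻ x in {x : ℝ | R < |x|}, J x) + stripConst β V *
          ((∫⁻ y in {y : ℝ | R / 2 < |y|}, ‖g y‖ₑ) + ENNReal.ofReal (d n))) + τ R) := by
          refine mul_le_mul_right (add_le_add ((htailn n R hR).trans ?_) (htail R hR)) _
          exact add_le_add le_rfl (mul_le_mul_right hγ _)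
      _ = _ := by
          simp only [hτ]
          ring
  rw [ENNReal.tendsto_nhds_zero]
  intro ε hε
  obtain ⟨R, hRε, hR⟩ := ((hτ0.eventually (gt_mem_nhds hε)).and (eventually_ge_atTop 1)).exists
  have hd0' : Tendsto (fun n => ENNReal.ofReal (d n)) atTop (𝓝 0) := by
    simpa using ENNReal.tendsto_ofReal hd0
  have hlim : Tendsto (fun n => (∫⁻ x in {x : ℝ | R < |x|}ᶜ, ‖D n x - D₀ x‖ₑ ^ q) +
      2 ^ (q - 1) * (2 * τ R + stripConst β V * ENNReal.ofReal (d n))) atTop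
      (𝓝 (2 ^ (q - 1) * (2 * τ R))) := by
    simpa using (hloc R (by linarith)).add (ENNReal.Tendsto.const_mul
      (tendsto_const_nhds.add (ENNReal.Tendsto.const_mul hd0' (Or.inr hSC)))
      (Or.inr (ENNReal.rpow_ne_top_of_nonneg (by linarith) (ENNReal.ofNat_ne_top (n := 2)))))
  filter_upwards [hlim.eventually (gt_mem_nhds hRε)] with n hn
  exact (hbound R hR n).trans hn.le

end Convergence

/-! ### Return to almost everywhere classes and proof of the theorem. -/

theorem fracMaxENN_eq_of_ae_eq {β : ℝ} {f F : ℝ → ℝ} (h : f =ᵐ[volume] F) :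
    fracMaxENN β f = fracMaxENN β fun y => |F y| :=
  fracMaxENN_congr (by filter_upwards [h] with y hy; rw [hy, abs_abs])

theorem fracMax_eq_of_ae_eq {β : ℝ} {f F : ℝ → ℝ} (h : f =ᵐ[volume] F) :
    fracMax β f = fracMax β fun y => |F y| := by
  funext x
  rw [fracMax, fracMax, fracMaxENN_eq_of_ae_eq h]

theorem normW11_eq {f f' F : ℝ → ℝ} (h : f =ᵐ[volume] F) (hF : IsACRep F f') :
    normW11 f f' = ENNReal.ofReal ((∫ y, |F y|) + ∫ y, |f' y|) := by
  rw [normW11, eLpNorm_congr_ae h, eLpNorm_one_eq_lintegral_enorm, eLpNorm_one_eq_lintegral_enorm,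
    lintegral_enorm_eq hF.integrable, lintegral_enorm_eq hF.integrable_deriv,
    ENNReal.ofReal_add (integral_nonneg fun y => abs_nonneg _)
      (integral_nonneg fun y => abs_nonneg _)]

theorem HasWeakDeriv.ae_eq_zero {f f' : ℝ → ℝ} (h : HasWeakDeriv f f') (hf : ∀ᵐ x, f x = 0) :
    ∀ᵐ x, f' x = 0 := by
  refine ae_eq_zero_of_integral_contDiff_smul_eq_zero h.locallyIntegrable_deriv
    fun φ hφ hφc => ?_
  have h1 := h.integral_mul_deriv φ hφ hφc
  rw [integral_eq_zero_of_ae (f := fun x => f x * deriv φ x)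
    (by filter_upwards [hf] with x hx; simp [hx])] at h1
  simp_rw [smul_eq_mul, mul_comm (φ _)]
  linarith

theorem enorm_abs_sub_abs_le (a b : ℝ) : ‖|a| - |b|‖ₑ ≤ ‖a - b‖ₑ := by
  rw [← Real.enorm_abs, ← Real.enorm_abs (a - b), Real.enorm_of_nonneg (abs_nonneg _),
    Real.enorm_of_nonneg (abs_nonneg _)]
  exact ENNReal.ofReal_le_ofReal (abs_abs_sub_abs_le_abs_sub _ _)

/-- Sequential continuity of `f ↦ |(M_β f)'|` at a nonzero function. -/
theorem IsACRep.tendsto_eLpNorm_deriv_fracMax {β : ℝ} (hβ0 : 0 < β) (hβ1 : β < 1)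
    {F g : ℝ → ℝ} {G γ : ℕ → ℝ → ℝ} (hF : IsACRep F g) (hG : ∀ n, IsACRep (G n) (γ n))
    {d : ℕ → ℝ} (hd : ∀ n, (∫ y, |G n y - F y|) + ∫ y, |γ n y - g y| ≤ d n)
    (hd0 : Tendsto d atTop (𝓝 0)) (hd1 : ∀ n, d n ≤ 1) (hFpos : 0 < ∫ y, |F y|)
    (hlt : ∀ n, ∫ y, |G n y - F y| < ∫ y, |F y|) :
    Tendsto (fun n => eLpNorm (fun x => |deriv (fracMax β fun y => |G n y|) x| -
      |deriv (fracMax β fun y => |F y|) x|) (ENNReal.ofReal (1 / (1 - β))) volume)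
      atTop (𝓝 0) := by
  have h1β : 0 < 1 - β := by linarith
  have tri : ∀ {a b : ℝ → ℝ}, Integrable a → Integrable b →
      ∫ y, |b y| ≤ (∫ y, |a y|) + ∫ y, |b y - a y| := by
    intro a b ha hb
    have hba : Integrable fun y => |b y - a y| := (hb.sub ha).abs
    rw [← integral_add ha.abs hba]
    refine integral_mono hb.abs (ha.abs.add hba) fun y => ?_
    have := abs_sub_abs_le_abs_sub (b y) (a y)
    change |b y| ≤ |a y| + |b y - a y|
    linarith
  have nn : ∀ a : ℝ → ℝ, 0 ≤ ∫ y, |a y| := fun a => integral_nonneg fun y => abs_nonneg _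
  have hGpos : ∀ n, 0 < ∫ y, |G n y| := by
    intro n
    have h1 := tri (hG n).integrable hF.integrable
    simp_rw [abs_sub_comm (F _)] at h1
    linarith [hlt n]
  have hGle : ∀ n, ∫ y, |G n y| ≤ (∫ y, |F y|) + 1 := fun n => by
    linarith [tri hF.integrable (hG n).integrable, hd n, hd1 n, nn fun y => γ n y - g y]
  have hγle : ∀ n, ∫ y, |γ n y| ≤ (∫ y, |g y|) + 1 := fun n => by
    linarith [tri hF.integrable_deriv (hG n).integrable_deriv, hd n, hd1 n,
      nn fun y => G n y - F y]
  -- As `d n ≤ 1`, adding `1` to the norms of `F` and `g` gives bounds common to the whole sequence.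
  have hlim := tendsto_lintegral_deriv_fracMax_sub hβ0 hβ1 hF hG
    (hF.isProfile (K := (∫ y, |F y|) + 1 + ((∫ y, |g y|) + 1)) (N := (∫ y, |F y|) + 1)
      (by linarith) (by linarith))
    (fun n => (hG n).isProfile (add_le_add (hGle n) (hγle n)) (hGle n)) hFpos hGpos
    (V := (∫ y, |g y|) + 1) (by linarith) hγle hd hd0
  set q := 1 / (1 - β) with hq
  have hq0 : 0 < q := by positivity
  have hroot := (ENNReal.continuous_rpow_const (y := 1 / q)).tendsto 0 |>.comp hlim
  rw [ENNReal.zero_rpow_of_pos (by positivity)] at hroot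
  refine tendsto_of_tendsto_of_tendsto_of_le_of_le tendsto_const_nhds hroot
    (fun _ => zero_le) fun n => ?_
  dsimp only [Function.comp]
  rw [eLpNorm_eq_lintegral_rpow_enorm_toReal (by simpa using hq0) ENNReal.ofReal_ne_top,
    ENNReal.toReal_ofReal hq0.le]
  gcongr
  exact enorm_abs_sub_abs_le _ _

theorem theorem1p1 (β : ℝ) (hβ0 : 0 < β) (hβ1 : β < 1) (q : ℝ) (hq : q = 1 / (1 - β)) :
    -- finiteness, almost everywhere differentiability and the endpoint Sobolev bound
    (∀ f f' : ℝ → ℝ, IsW11 f f' →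
      (∀ x, fracMaxENN β f x < (⊤ : ℝ≥0∞)) ∧
      (∀ᵐ x, DifferentiableAt ℝ (fracMax β f) x) ∧
      MemLp (deriv (fracMax β f)) (ENNReal.ofReal q) volume ∧
      eLpNorm (deriv (fracMax β f)) (ENNReal.ofReal q) volume ≤
        ENNReal.ofReal ((2 : ℝ) ^ (-3 * β - 2 + 4 / β) * (3 : ℝ) ^ (2 * (1 - β) ^ 2 / β)) *
          eLpNorm f' 1 volume) ∧
    -- continuity of `f ↦ |(M_β f)'|` from `W^{1,1}(ℝ)` to `L^q(ℝ)`
    (∀ f f' : ℝ → ℝ, IsW11 f f' → ∀ ε : ℝ≥0∞, 0 < ε → ∃ δ : ℝ≥0∞, 0 < δ ∧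
      ∀ g g' : ℝ → ℝ, IsW11 g g' → normW11 (g - f) (g' - f') < δ →
        eLpNorm (fun x => |deriv (fracMax β g) x| - |deriv (fracMax β f) x|)
          (ENNReal.ofReal q) volume < ε) := by
  subst hq
  constructor
  · intro f f' hf
    obtain ⟨F, hF, hfF⟩ := hf.exists_isACRep
    have h := hF.isProfile le_rfl le_rfl
    have hbound := hF.eLpNorm_deriv_fracMax_le hβ0 hβ1
    rw [fracMaxENN_eq_of_ae_eq hfF, fracMax_eq_of_ae_eq hfF]
    refine ⟨fracMaxENN_lt_top hβ0 hβ1 h, ?_, ⟨(measurable_deriv _).aestronglyMeasurable, ?_⟩,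
      hbound⟩
    · by_cases hpos : 0 < ∫ y, |F y|
      · exact ae_differentiableAt_fracMax hβ0 hβ1 h hpos
      · rw [fracMax_eq_zero h hpos]
        exact Eventually.of_forall fun x => differentiableAt_const _
    · exact hbound.trans_lt (ENNReal.mul_lt_top ENNReal.ofReal_lt_top
        (memLp_one_iff_integrable.2 hF.integrable_deriv).2)
  · intro f f' hf ε hε
    obtain ⟨F, hF, hfF⟩ := hf.exists_isACRep
    have h := hF.isProfile le_rfl le_rfl
    by_cases hpos : 0 < ∫ y, |F y|
    · by_contra! hcon
      -- The second term of the minimum keeps the `L¹` distance to `F` below `‖F‖₁`, so each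
      -- approximant is nonzero and has optimal radii.
      choose G G' hG hdist hge using fun n : ℕ => hcon
        (min (ENNReal.ofReal (1 / ((n : ℝ) + 1))) (ENNReal.ofReal (∫ y, |F y|)))
        (lt_min (ENNReal.ofReal_pos.2 (by positivity)) (ENNReal.ofReal_pos.2 hpos))
      choose H hH hGH using fun n => (hG n).exists_isACRep
      have hlt : ∀ n, (∫ y, |H n y - F y|) + (∫ y, |G' n y - f' y|) < 1 / ((n : ℝ) + 1) ∧
          (∫ y, |H n y - F y|) + (∫ y, |G' n y - f' y|) < ∫ y, |F y| := by
        intro n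
        have h1 := hdist n
        rw [normW11_eq ((hGH n).sub hfF) ((hH n).sub hF), lt_min_iff,
          ENNReal.ofReal_lt_ofReal_iff (by positivity), ENNReal.ofReal_lt_ofReal_iff hpos] at h1
        exact h1
      have hlim := hF.tendsto_eLpNorm_deriv_fracMax hβ0 hβ1 hH (fun n => (hlt n).1.le)
        tendsto_one_div_add_atTop_nhds_zero_nat
        (fun n => by
          rw [div_le_one (by positivity)]
          linarith [(Nat.cast_nonneg n : (0 : ℝ) ≤ n)]) hpos
        (fun n => (le_add_of_nonneg_right (integral_nonneg fun y => abs_nonneg _)).trans_lt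
          (hlt n).2)
      obtain ⟨n, hn⟩ := (hlim.eventually (gt_mem_nhds hε)).exists
      refine (hge n).not_gt ?_
      rwa [fracMax_eq_of_ae_eq (hGH n), fracMax_eq_of_ae_eq hfF]
    -- When `f = 0`, also `f' = 0` almost everywhere, and the endpoint bound for `g` gives
    -- continuity with `δ = ε / (C + 1)`, the `+ 1` keeping the denominator nonzero.
    · have hF0 : ∀ᵐ x, F x = 0 := by
        have h0 : ∫ y, |F y| = 0 :=
          le_antisymm (not_lt.1 hpos) (integral_nonneg fun y => abs_nonneg _)
        rw [integral_eq_zero_iff_of_nonneg (fun y => abs_nonneg _) h.integrable] at h0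
        filter_upwards [h0] with x hx
        simpa using hx
      have hf'0 : ∀ᵐ x, f' x = 0 := hf.hasWeakDeriv.ae_eq_zero (by
        filter_upwards [hfF, hF0] with x h1 h2
        rw [h1, h2])
      obtain ⟨C, hC, hbound⟩ : ∃ C : ℝ≥0∞, C ≠ ⊤ ∧ ∀ G g : ℝ → ℝ, IsACRep G g →
          eLpNorm (deriv (fracMax β fun y => |G y|)) (ENNReal.ofReal (1 / (1 - β))) volume ≤
            C * eLpNorm g 1 volume :=
        ⟨_, ENNReal.ofReal_ne_top, fun G g hG => hG.eLpNorm_deriv_fracMax_le hβ0 hβ1⟩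
      have hC1 : C + 1 ≠ ⊤ := ENNReal.add_ne_top.2 ⟨hC, ENNReal.one_ne_top⟩
      refine ⟨ε / (C + 1), ENNReal.div_pos hε.ne' hC1, fun g g' hg hdist => ?_⟩
      obtain ⟨G, hG, hgG⟩ := hg.exists_isACRep
      rw [fracMax_eq_of_ae_eq hfF, fracMax_eq_zero h hpos, fracMax_eq_of_ae_eq hgG]
      have hsub : eLpNorm g' 1 volume ≤ normW11 (g - f) (g' - f') := by
        rw [eLpNorm_congr_ae (g := g' - f') (by
          filter_upwards [hf'0] with x hx
          simp [hx])]
        exact le_add_self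
      have habs : eLpNorm (fun x => |deriv (fracMax β fun y => |G y|) x| -
          |deriv (fun _ : ℝ => (0 : ℝ)) x|) (ENNReal.ofReal (1 / (1 - β))) volume =
          eLpNorm (deriv (fracMax β fun y => |G y|)) (ENNReal.ofReal (1 / (1 - β))) volume :=
        eLpNorm_congr_norm_ae (Eventually.of_forall fun x => by simp)
      rw [habs]
      calc _ ≤ C * eLpNorm g' 1 volume := hbound G g' hG
        _ ≤ normW11 (g - f) (g' - f') * (C + 1) := by
            rw [mul_comm]
            exact mul_le_mul' hsub le_self_add
        _ < ε := (ENNReal.lt_div_iff_mul_lt (Or.inl (by simp)) (Or.inl hC1)).1 hdist
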